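/- Let $k$ be a field; all algebras and unadorned $\otimes$ are over $k$. A weak Hopf algebra $H$ is a $k$-algebra and $k$-coalgebra $(H,\Delta,\varepsilon)$ such that, in Sweedler notation, $\Delta(hg)=\Delta(h)\Delta(g)$, $$1_1\otimes\Delta(1_2)=1_1\otimes 1_2 1'_1\otimes 1'_2=1_1\otimes 1'_1 1_2\otimes 1'_2,\qquad \varepsilon(hgl)=\varepsilon(hg_1)\varepsilon(g_2l)=\varepsilon(hg_2)\varepsilon(g_1l)$$ for all $h,g,l\in H$ (where $1'$ is another copy of $1$), together with a $k$-linear map $S:H\to H$ satisfying $S*\mathrm{id}_H=\varepsilon_s$, $\mathrm{id}_H*S=\varepsilon_t$ and $S*\mathrm{id}_H*S=S$, where $*$ is the convolution product, $\varepsilon_t(h)=\varepsilon(1_1h)1_2$ and $\varepsilon_s(h)=1_1\varepsilon(h1_2)$. Put $H_t=\varepsilon_t(H)$. Let $H$ be a finite-dimensional weak Hopf algebra over $k$ and let $A$ be a right weak $H$-comodule algebra, that is, a $k$-algebra with a right $H$-comodule structure $\rho:A\to A\otimes H$, $\rho(a)=a_0\otimes a_1$, such that $\rho(ab)=\rho(a)\rho(b)$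 for all $a,b\in A$ and $\rho(1)\in A\otimes H_t$. Let $$B=A^{\mathrm{co}H}=\{a\in A:\ \rho(a)=1_0a\otimes 1_1\},$$ a subalgebra of $A$. Assume that $A/B$ is right weak $H$-Galois, i.e. that the map $$\beta:A\otimes_BA\to A\otimes_tH:=(A\otimes H)\rho(1),\qquad a\otimes_B b\mapsto ab_0\otimes b_1,$$ is bijective, and that $A$ is faithfully flat as a right $B$-module. For a ring $R$ let $\operatorname{fin.dim}R$ be the supremum of the projective dimensions of the finitely generated left $R$-modules of finite projective dimension. If $\operatorname{fin.dim}B<\infty$, then $\operatorname{fin.dim}B\le\operatorname{fin.dim}A$. -/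

import Mathlib

open scoped TensorProduct

universe u v w

noncomputable section

/-! ### Weak bialgebras and weak Hopf algebras -/

section WeakHopf

variable (k : Type u) (H : Type v) [Field k] [Ring H] [Algebra k H] [Coalgebra k H]

/-- A weak bialgebra: an algebra and a coalgebra with multiplicative comultiplication, such that
`Δ²(1) = 1₁ ⊗ 1₂1'₁ ⊗ 1'₂ = 1₁ ⊗ 1'₁1₂ ⊗ 1'₂` and
`ε(hgl) = ε(hg₁)ε(g₂l) = ε(hg₂)ε(g₁l)`. -/
class WeakBialgebra : Prop where
  comul_mul : ∀ h g : H,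
    Coalgebra.comul (R := k) (h * g) = Coalgebra.comul (R := k) h * Coalgebra.comul (R := k) g
  comul_comul_one :
    (Coalgebra.comul (R := k) (A := H)).lTensor H (Coalgebra.comul (R := k) (1 : H)) =
      TensorProduct.assoc k H H H (Coalgebra.comul (R := k) (1 : H) ⊗ₜ[k] (1 : H)) *
        ((1 : H) ⊗ₜ[k] Coalgebra.comul (R := k) (1 : H))
  comul_comul_one' :
    (Coalgebra.comul (R := k) (A := H)).lTensor H (Coalgebra.comul (R := k) (1 : H)) =
      ((1 : H) ⊗ₜ[k] Coalgebra.comul (R := k) (1 : H)) *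
        TensorProduct.assoc k H H H (Coalgebra.comul (R := k) (1 : H) ⊗ₜ[k] (1 : H))
  counit_mul_mul : ∀ h g l : H,
    Coalgebra.counit (R := k) (h * g * l) =
      LinearMap.mul' k k (TensorProduct.map
        (Coalgebra.counit (R := k) ∘ₗ LinearMap.mulLeft k h)
        (Coalgebra.counit (R := k) ∘ₗ LinearMap.mulRight k l) (Coalgebra.comul (R := k) g))
  counit_mul_mul' : ∀ h g l : H,
    Coalgebra.counit (R := k) (h * g * l) =
      LinearMap.mul' k k (TensorProduct.map
        (Coalgebra.counit (R := k) ∘ₗ LinearMap.mulRight k l)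
        (Coalgebra.counit (R := k) ∘ₗ LinearMap.mulLeft k h) (Coalgebra.comul (R := k) g))

/-- The target map `ε_t(h) = ε(1₁h)1₂`. -/
def targetMap : H →ₗ[k] H where
  toFun h := TensorProduct.lid k H
    ((Coalgebra.counit (R := k) ∘ₗ LinearMap.mulRight k h).rTensor H
      (Coalgebra.comul (R := k) (1 : H)))
  map_add' x y := by
    have : LinearMap.mulRight k (x + y) = LinearMap.mulRight k x + LinearMap.mulRight k y := by
      ext; simp [mul_add]
    rw [this, LinearMap.comp_add, LinearMap.rTensor_add, LinearMap.add_apply, map_add]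
  map_smul' c x := by
    have : LinearMap.mulRight k (c • x) = c • LinearMap.mulRight k x := by
      ext; simp
    rw [this, LinearMap.comp_smul, LinearMap.rTensor_smul, LinearMap.smul_apply, map_smul,
      RingHom.id_apply]

/-- The source map `ε_s(h) = 1₁ε(h1₂)`. -/
def sourceMap : H →ₗ[k] H where
  toFun h := TensorProduct.rid k H
    ((Coalgebra.counit (R := k) ∘ₗ LinearMap.mulLeft k h).lTensor H
      (Coalgebra.comul (R := k) (1 : H)))
  map_add' x y := by
    have : LinearMap.mulLeft k (x + y) = LinearMap.mulLeft k x + LinearMap.mulLeft k y := by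
      ext; simp [add_mul]
    rw [this, LinearMap.comp_add, LinearMap.lTensor_add, LinearMap.add_apply, map_add]
  map_smul' c x := by
    have : LinearMap.mulLeft k (c • x) = c • LinearMap.mulLeft k x := by
      ext; simp
    rw [this, LinearMap.comp_smul, LinearMap.lTensor_smul, LinearMap.smul_apply, map_smul,
      RingHom.id_apply]

/-- The target space `H_t`, the image of the target map. -/
def targetSpace : Submodule k H := LinearMap.range (targetMap k H)

variable {k H} in
/-- The convolution product `(f * g)(h) = f(h₁)g(h₂)` of linear endomorphisms of `H`. -/
def convolution (f g : H →ₗ[k] H) : H →ₗ[k] H :=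
  LinearMap.mul' k H ∘ₗ TensorProduct.map f g ∘ₗ Coalgebra.comul

variable {k H} in
/-- `Δ(x) = x1₁ ⊗ 1₂` for `x ∈ H_t`. -/
theorem comul_of_mem_targetSpace [WeakBialgebra k H] {x : H} (hx : x ∈ targetSpace k H) :
    Coalgebra.comul (R := k) x = (x ⊗ₜ[k] (1 : H)) * Coalgebra.comul (R := k) (1 : H) := by
  obtain ⟨h, rfl⟩ := hx
  simp only [targetMap, LinearMap.coe_mk, AddHom.coe_mk]
  generalize Coalgebra.counit (R := k) ∘ₗ LinearMap.mulRight k h = φ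
  have h1 : ∀ z : H ⊗[k] H, Coalgebra.comul (R := k) (TensorProduct.lid k H (φ.rTensor H z)) =
      TensorProduct.lid k (H ⊗[k] H) (φ.rTensor (H ⊗[k] H)
        ((Coalgebra.comul (R := k) (A := H)).lTensor H z)) := by
    intro z
    induction z with
    | zero => simp
    | tmul p q => simp
    | add p q hp hq => simp only [map_add, hp, hq]
  have h2 : ∀ z w : H ⊗[k] H, TensorProduct.lid k (H ⊗[k] H) (φ.rTensor (H ⊗[k] H)
      (TensorProduct.assoc k H H H (z ⊗ₜ[k] (1 : H)) * ((1 : H) ⊗ₜ[k] w))) =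
      (TensorProduct.lid k H (φ.rTensor H z) ⊗ₜ[k] (1 : H)) * w := by
    intro z w
    induction z with
    | zero => simp
    | tmul p q => simp [← TensorProduct.smul_tmul']
    | add p q hp hq => simp only [map_add, TensorProduct.add_tmul, add_mul, hp, hq]
  rw [h1, WeakBialgebra.comul_comul_one, h2]

/-- A weak Hopf algebra: a weak bialgebra with an antipode `S` such that
`S * id = ε_s`, `id * S = ε_t` and `S * id * S = S` for the convolution product. -/
class WeakHopfAlgebra extends WeakBialgebra k H where
  antipode : H →ₗ[k] H
  antipode_conv_id : convolution antipode LinearMap.id = sourceMap k H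
  id_conv_antipode : convolution LinearMap.id antipode = targetMap k H
  antipode_conv_id_conv_antipode :
    convolution (convolution antipode LinearMap.id) antipode = antipode

end WeakHopf

/-! ### Tensor products over a subalgebra -/

section RelTensor

variable {k : Type u} {A : Type w} [Field k] [Ring A] [Algebra k A] (B : Subalgebra k A)

/-- The relations `ab ⊗ m = a ⊗ bm` (`b ∈ B`) in `A ⊗_ℤ M`. The set of generators is stable under
left multiplication by `A`, so its `A`-span is the additive subgroup that it generates. -/
def relTensorRel (M : Type*) [AddCommGroup M] [Module B M] : Submodule A (A ⊗[ℤ] M) :=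
  Submodule.span A {x | ∃ (a : A) (b : B) (m : M),
    x = (a * (b : A)) ⊗ₜ[ℤ] m - a ⊗ₜ[ℤ] (b • m)}

/-- The left `A`-module `A ⊗_B M`, for a left module `M` over a subalgebra `B` of `A`. -/
abbrev RelTensor (M : Type*) [AddCommGroup M] [Module B M] : Type _ :=
  (A ⊗[ℤ] M) ⧸ relTensorRel B M

/-- The map `A ⊗_B f : A ⊗_B M → A ⊗_B N`, `a ⊗ m ↦ a ⊗ f m`. -/
def RelTensor.map {M N : Type*} [AddCommGroup M] [Module B M] [AddCommGroup N] [Module B N]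
    (f : M →ₗ[B] N) : RelTensor B M →ₗ[A] RelTensor B N :=
  Submodule.mapQ (relTensorRel B M) (relTensorRel B N)
    (LinearMap.baseChange A f.toAddMonoidHom.toIntLinearMap) (by
      refine Submodule.span_le.2 ?_
      rintro _ ⟨a, b, m, rfl⟩
      refine Submodule.subset_span ⟨a, b, f m, ?_⟩
      simp)

/-- `A` is faithfully flat as a right `B`-module: a sequence `M → N → P` of left `B`-modules is
exact if and only if `A ⊗_B M → A ⊗_B N → A ⊗_B P` is exact. -/
def IsRightFaithfullyFlat : Prop :=
  ∀ (M N P : Type w) [AddCommGroup M] [AddCommGroup N] [AddCommGroup P]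
    [Module B M] [Module B N] [Module B P] (f : M →ₗ[B] N) (g : N →ₗ[B] P),
    Function.Exact f g ↔ Function.Exact (RelTensor.map B f) (RelTensor.map B g)

end RelTensor

/-! ### Weak comodule algebras and weak Galois extensions -/

section Galois

variable (k : Type u) (H : Type v) (A : Type w) [Field k] [Ring H] [Algebra k H] [Coalgebra k H]
  [Ring A] [Algebra k A]

/-- A right weak `H`-comodule algebra structure on the algebra `A`: a right `H`-comodule structure
`ρ : A → A ⊗ H` that is multiplicative and satisfies `ρ(1) ∈ A ⊗ H_t`. -/
structure WeakComoduleAlgebra where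
  coact : A →ₗ[k] A ⊗[k] H
  coassoc : ∀ a : A, TensorProduct.assoc k A H H (coact.rTensor H (coact a)) =
    (Coalgebra.comul (R := k) (A := H)).lTensor A (coact a)
  counit_coact : ∀ a : A, TensorProduct.rid k A
    ((Coalgebra.counit (R := k) (A := H)).lTensor A (coact a)) = a
  coact_mul : ∀ a b : A, coact (a * b) = coact a * coact b
  coact_one_mem : coact 1 ∈ LinearMap.range ((targetSpace k H).subtype.lTensor A)

namespace WeakComoduleAlgebra

variable {k H A} (ρ : WeakComoduleAlgebra k H A)

/-- The subalgebra of coinvariants `A^{co H} = {a | ρ(a) = 1₀a ⊗ 1₁}`. -/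
def coinvariants : Subalgebra k A where
  carrier := {a | ρ.coact a = ρ.coact 1 * (a ⊗ₜ[k] 1)}
  mul_mem' {a b} ha hb := by
    simp only [Set.mem_ofPred_eq] at ha hb ⊢
    have h1 : ρ.coact a * ρ.coact 1 = ρ.coact a := by rw [← ρ.coact_mul, mul_one]
    rw [ρ.coact_mul, hb, ← mul_assoc, h1, ha, mul_assoc]
    simp
  add_mem' {a b} ha hb := by
    simp only [Set.mem_ofPred_eq] at ha hb ⊢
    rw [map_add, ha, hb, ← mul_add, TensorProduct.add_tmul]
  algebraMap_mem' c := by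
    simp only [Set.mem_ofPred_eq]
    rw [Algebra.algebraMap_eq_smul_one, map_smul, ← TensorProduct.smul_tmul',
      mul_smul_comm, ← Algebra.TensorProduct.one_def, mul_one]

/-- `A ⊗_t H = (A ⊗ H)ρ(1)`, as a left `A`-submodule of `A ⊗ H`. -/
def targetTensor : Submodule A (A ⊗[k] H) where
  carrier := {x | ∃ y : A ⊗[k] H, x = y * ρ.coact 1}
  add_mem' := by
    rintro _ _ ⟨x, rfl⟩ ⟨y, rfl⟩
    exact ⟨x + y, (add_mul _ _ _).symm⟩
  zero_mem' := ⟨0, (zero_mul _).symm⟩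
  smul_mem' := by
    rintro a _ ⟨x, rfl⟩
    exact ⟨a • x, (smul_mul_assoc _ _ _).symm⟩

/-- `ε(x1₁)1₂ = x` for `x ∈ H_t`. -/
theorem counit_mul_of_mem_targetSpace [WeakBialgebra k H] {x : H} (hx : x ∈ targetSpace k H) :
    TensorProduct.lid k H ((Coalgebra.counit (R := k) (A := H)).rTensor H
      ((x ⊗ₜ[k] (1 : H)) * Coalgebra.comul (R := k) (1 : H))) = x := by
  rw [← comul_of_mem_targetSpace hx, Coalgebra.rTensor_counit_comul]
  simp

/-- Coinvariants also satisfy `ρ(b) = b1₀ ⊗ 1₁`. -/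
theorem coact_of_mem_coinvariants [WeakBialgebra k H] {b : A} (hb : b ∈ ρ.coinvariants) :
    ρ.coact b = b • ρ.coact 1 := by
  replace hb : ρ.coact b = ρ.coact 1 * (b ⊗ₜ[k] 1) := hb
  -- `Φ (a ⊗ h) = a ⊗ ε(h1₁)1₂`
  let E : (A ⊗[k] H) ⊗[k] H →ₗ[k] A ⊗[k] H :=
    ((TensorProduct.rid k A).toLinearMap ∘ₗ
      (Coalgebra.counit (R := k) (A := H)).lTensor A).rTensor H
  let Φ : A ⊗[k] H → A ⊗[k] H := fun z =>
    E ((z ⊗ₜ[k] (1 : H)) * (TensorProduct.assoc k A H H).symm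
      ((1 : A) ⊗ₜ[k] Coalgebra.comul (R := k) (1 : H)))
  have Φadd : ∀ x y, Φ (x + y) = Φ x + Φ y := fun x y => by
    simp only [Φ, TensorProduct.add_tmul, add_mul, map_add]
  have Φzero : Φ 0 = 0 := by simp [Φ]
  have Etmul : ∀ (a : A) (h : H) (w : H ⊗[k] H),
      E (((a ⊗ₜ[k] h) ⊗ₜ[k] (1 : H)) * (TensorProduct.assoc k A H H).symm ((1 : A) ⊗ₜ[k] w)) =
      a ⊗ₜ[k] TensorProduct.lid k H ((Coalgebra.counit (R := k) (A := H)).rTensor H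
        ((h ⊗ₜ[k] (1 : H)) * w)) := by
    intro a h w
    induction w with
    | zero => simp
    | tmul p q => simp [E, TensorProduct.smul_tmul]
    | add p q hp hq => simp only [map_add, TensorProduct.tmul_add, mul_add, hp, hq]
  obtain ⟨t, ht⟩ := ρ.coact_one_mem
  have hfix : Φ (ρ.coact b) = ρ.coact b := by
    rw [hb, ← ht]
    clear ht
    induction t with
    | zero => simp [Φzero]
    | tmul u x =>
      simp only [LinearMap.lTensor_tmul, Submodule.subtype_apply,
        Algebra.TensorProduct.tmul_mul_tmul, mul_one]
      simp only [Φ]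
      rw [Etmul, counit_mul_of_mem_targetSpace x.2]
    | add p q hp hq => simp only [map_add, add_mul, Φadd, hp, hq]
  have hone : ρ.coact.rTensor H (ρ.coact 1) = (ρ.coact 1 ⊗ₜ[k] (1 : H)) *
      (TensorProduct.assoc k A H H).symm
        ((1 : A) ⊗ₜ[k] Coalgebra.comul (R := k) (1 : H)) := by
    rw [← LinearEquiv.symm_apply_apply (TensorProduct.assoc k A H H)
      (ρ.coact.rTensor H (ρ.coact 1)), ρ.coassoc, ← ht]
    clear hfix ht
    have aux : ∀ (a : A) (h : H) (w : H ⊗[k] H),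
        (TensorProduct.assoc k A H H).symm (a ⊗ₜ[k] ((h ⊗ₜ[k] (1 : H)) * w)) =
        ((a ⊗ₜ[k] h) ⊗ₜ[k] (1 : H)) *
          (TensorProduct.assoc k A H H).symm ((1 : A) ⊗ₜ[k] w) := by
      intro a h w
      induction w with
      | zero => simp
      | tmul p q => simp
      | add p q hp hq => simp only [map_add, TensorProduct.tmul_add, mul_add, hp, hq]
    induction t with
    | zero => simp
    | tmul u x =>
      simp only [LinearMap.lTensor_tmul, Submodule.subtype_apply]
      rw [comul_of_mem_targetSpace x.2, aux]
    | add p q hp hq => simp only [map_add, TensorProduct.add_tmul, add_mul, hp, hq]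
  have hmul : ∀ z : A ⊗[k] H, ρ.coact.rTensor H (b • z) =
      (ρ.coact b ⊗ₜ[k] (1 : H)) * ρ.coact.rTensor H z := by
    intro z
    induction z with
    | zero => simp
    | tmul p q => simp [TensorProduct.smul_tmul', ρ.coact_mul]
    | add p q hp hq => simp only [smul_add, map_add, mul_add, hp, hq]
  have hE : ∀ z : A ⊗[k] H, E (ρ.coact.rTensor H z) = z := by
    intro z
    induction z with
    | zero => simp
    | tmul p q => simp [E, ρ.counit_coact]
    | add p q hp hq => simp only [map_add, hp, hq]
  rw [← hfix, ← hE (b • ρ.coact 1), hmul, hone, ← mul_assoc,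
    Algebra.TensorProduct.tmul_mul_tmul, ← ρ.coact_mul, mul_one, mul_one]

/-- The map `A ⊗_ℤ A → A ⊗ H`, `a ⊗ b ↦ ab₀ ⊗ b₁`. -/
def preGalois : A ⊗[ℤ] A →ₗ[A] A ⊗[k] H :=
  TensorProduct.AlgebraTensorModule.lift
    (LinearMap.toSpanSingleton A (A →ₗ[ℤ] A ⊗[k] H) ρ.coact.toAddMonoidHom.toIntLinearMap)

theorem preGalois_tmul (a b : A) : ρ.preGalois (a ⊗ₜ[ℤ] b) = a • ρ.coact b := rfl

theorem preGalois_mem (x : A ⊗[ℤ] A) : ρ.preGalois x ∈ ρ.targetTensor := by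
  induction x with
  | zero => simp
  | tmul a b =>
    refine ⟨a • ρ.coact b, ?_⟩
    rw [preGalois_tmul, smul_mul_assoc, ← ρ.coact_mul, mul_one]
  | add x y hx hy => rw [map_add]; exact add_mem hx hy

/-- The canonical map `β : A ⊗_B A → A ⊗_t H`, `a ⊗ b ↦ ab₀ ⊗_t b₁`, where `B = A^{co H}`. -/
def galoisMap [WeakBialgebra k H] :
    RelTensor ρ.coinvariants A →ₗ[A] ρ.targetTensor :=
  Submodule.liftQ (relTensorRel ρ.coinvariants A)
    (LinearMap.codRestrict ρ.targetTensor ρ.preGalois ρ.preGalois_mem) (by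
      refine Submodule.span_le.2 ?_
      rintro _ ⟨a, b, c, rfl⟩
      refine Subtype.ext ?_
      have hb : ρ.coact ((b : A) * c) = (b : A) • ρ.coact c := by
        rw [ρ.coact_mul, ρ.coact_of_mem_coinvariants b.2, smul_mul_assoc, ← ρ.coact_mul, one_mul]
      simp [preGalois_tmul, Subalgebra.smul_def, hb, mul_smul])

/-- The value of `β` on `a ⊗ b` is `(a ⊗ 1)ρ(b)`. -/
theorem galoisMap_mk_tmul [WeakBialgebra k H] (a b : A) :
    (ρ.galoisMap (Submodule.Quotient.mk (a ⊗ₜ[ℤ] b)) : A ⊗[k] H) =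
      (a ⊗ₜ[k] 1) * ρ.coact b := by
  change a • ρ.coact b = _
  generalize ρ.coact b = z
  induction z with
  | zero => simp
  | tmul p q => simp [TensorProduct.smul_tmul']
  | add p q hp hq => simp only [smul_add, mul_add, hp, hq]

/-- `A / A^{co H}` is a right weak `H`-Galois extension: `β` is bijective. -/
def IsWeakGalois [WeakBialgebra k H] : Prop := Function.Bijective ρ.galoisMap

end WeakComoduleAlgebra

end Galois

/-! ### Finitistic dimension -/

/-- The finitistic dimension of `R`: the supremum of the projective dimensions of the finitely
generated left `R`-modules of finite projective dimension. (The zero module has projective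
dimension `⊥`, and `⊤` stands for `∞`.) -/
def finitisticDimension (R : Type w) [Ring R] : WithBot ℕ∞ :=
  sSup {d | ∃ M : ModuleCat.{w} R, Module.Finite R M ∧
    CategoryTheory.projectiveDimension M < ⊤ ∧ d = CategoryTheory.projectiveDimension M}

end

/-!
Every functional `φ` on `H` gives a trace integral `T = (x ↦ tr (w ↦ φ ⇀ x S²(w)))`, for which
`a ↦ a₀ T(a₁)` is a left `B`-linear map `A → B`. Applied to the preimages under `β` of the tensors
`1₀ ⊗ h 1₁`, finitely many of these maps form a finite dual basis, so `A` is a finitely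
generated projective left `B`-module.

Now let `M` be a finitely generated `B`-module with `pd M = fin.dim B`. By faithful flatness `M`
embeds into `A ⊗_B M`, and the cokernel is finitely generated over `B`, so if its projective
dimension is finite, it is at most `fin.dim B`. Hence
`fin.dim B = pd_B M ≤ pd_B (A ⊗_B M) ≤ pd_A (A ⊗_B M) ≤ fin.dim A`.
-/

noncomputable section

section FinitisticDimension

open CategoryTheory

section Functor

variable {C D : Type*} [Category C] [Abelian C] [Category D] [Abelian D]

theorem projectiveDimension_le_of_forall_hasProjectiveDimensionLT {X : C} {Y : D}
    (h : ∀ n, HasProjectiveDimensionLT X n → HasProjectiveDimensionLT Y n) :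
    projectiveDimension Y ≤ projectiveDimension X :=
  sInf_le_sInf fun _ hn i hi => h i (hn i hi)

variable [EnoughProjectives C] (F : C ⥤ D) [F.PreservesZeroMorphisms]
  [F.PreservesProjectiveObjects] (hF : ∀ S : ShortComplex C, S.ShortExact → (S.map F).ShortExact)
include hF

theorem hasProjectiveDimensionLE_obj_of_forall_shortExact_map {X : C} {n : ℕ}
    (hX : HasProjectiveDimensionLE X n) : HasProjectiveDimensionLE (F.obj X) n := by
  induction n generalizing X with
  | zero =>
    rw [← projective_iff_hasProjectiveDimensionLE_zero] at hX ⊢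
    exact F.projective_obj X
  | succ n ih =>
    obtain ⟨⟨P, f⟩⟩ := EnoughProjectives.presentation X
    let S := ShortComplex.mk (Limits.kernel.ι f) f (Limits.kernel.condition f)
    have hS : S.ShortExact := { exact := ShortComplex.exact_kernel f }
    have hK : HasProjectiveDimensionLE (Limits.kernel f) n :=
      (hS.hasProjectiveDimensionLT_X₃_iff n ‹_›).1 hX
    exact ((hF S hS).hasProjectiveDimensionLT_X₃_iff n (F.projective_obj P)).2 (ih hK)

theorem projectiveDimension_obj_le_of_forall_shortExact_map (X : C) :
    projectiveDimension (F.obj X) ≤ projectiveDimension X := by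
  refine projectiveDimension_le_of_forall_hasProjectiveDimensionLT fun n hX => ?_
  obtain _ | n := n
  · rw [hasProjectiveDimensionLT_zero_iff_isZero] at hX ⊢
    exact F.map_isZero hX
  · exact hasProjectiveDimensionLE_obj_of_forall_shortExact_map F hF hX

end Functor

section WithBotENat

theorem eq_bot_or_eq_natCast_of_lt_top {d : WithBot ℕ∞} (hd : d < ⊤) : d = ⊥ ∨ ∃ n : ℕ, d = n := by
  induction d with
  | bot => exact .inl rfl
  | coe d =>
    obtain ⟨n, rfl⟩ := ENat.ne_top_iff_exists.1 (WithBot.coe_lt_coe.1 hd).ne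
    exact .inr ⟨n, rfl⟩

theorem finite_Iic_of_lt_top {d : WithBot ℕ∞} (hd : d < ⊤) : (Set.Iic d).Finite := by
  obtain rfl | ⟨n, rfl⟩ := eq_bot_or_eq_natCast_of_lt_top hd
  · simp
  · refine ((Set.finite_Iic n).image ((↑) : ℕ → WithBot ℕ∞)).insert ⊥ |>.subset fun e he => ?_
    obtain rfl | ⟨m, rfl⟩ := eq_bot_or_eq_natCast_of_lt_top (he.trans_lt hd)
    · exact .inl rfl
    · exact .inr ⟨m, by simpa using he, rfl⟩

end WithBotENat

section Ring

variable {R : Type w} [Ring R]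

theorem projectiveDimension_le_finitisticDimension (M : ModuleCat.{w} R) [Module.Finite R M]
    (hM : projectiveDimension M < ⊤) : projectiveDimension M ≤ finitisticDimension R :=
  le_sSup ⟨M, ‹_›, hM, rfl⟩

theorem exists_projectiveDimension_eq_finitisticDimension (h : finitisticDimension R < ⊤) :
    ∃ M : ModuleCat.{w} R, Module.Finite R M ∧ projectiveDimension M = finitisticDimension R := by
  have hbot : projectiveDimension (ModuleCat.of R PUnit.{w + 1}) = ⊥ := by
    rw [projectiveDimension_eq_bot_iff, ModuleCat.isZero_iff_subsingleton]
    infer_instance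
  let s : Set (WithBot ℕ∞) := {d | ∃ M : ModuleCat.{w} R, Module.Finite R M ∧
    projectiveDimension M < ⊤ ∧ d = projectiveDimension M}
  have hs : s.Nonempty := ⟨_, ModuleCat.of R PUnit.{w + 1}, inferInstance, by simp [hbot], rfl⟩
  have hfin : s.Finite := (finite_Iic_of_lt_top h).subset fun _ => le_sSup
  obtain ⟨M, hM, -, hd⟩ := hs.csSup_mem hfin
  exact ⟨M, hM, hd.symm⟩

theorem projectiveDimension_le_of_mono_of_eq_finitisticDimension {M N : ModuleCat.{w} R}
    (f : M ⟶ N) [Mono f] [Module.Finite R N] (hM : projectiveDimension M = finitisticDimension R)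
    (hfin : finitisticDimension R < ⊤) : projectiveDimension M ≤ projectiveDimension N := by
  obtain hbot | ⟨n, hn⟩ := eq_bot_or_eq_natCast_of_lt_top (hM ▸ hfin)
  · exact hbot ▸ bot_le
  by_contra hlt
  rw [hn, projectiveDimension_ge_iff, not_not] at hlt
  let S := ShortComplex.mk f (Limits.cokernel.π f) (Limits.cokernel.condition f)
  have hS : S.ShortExact := { exact := ShortComplex.exact_cokernel f }
  have : Module.Finite R S.X₃ :=
    .of_surjective (Limits.cokernel.π f).hom ((ModuleCat.epi_iff_surjective _).1 inferInstance)
  have hC : projectiveDimension S.X₃ < ⊤ :=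
    lt_top_iff_ne_top.2 <| (projectiveDimension_ne_top_iff _).2 ⟨n + 1,
      hS.hasProjectiveDimensionLT_X₃ (n + 1) ((projectiveDimension_le_iff M n).1 hn.le)
        (hasProjectiveDimensionLT_of_ge N n (n + 2) (by lia))⟩
  have hCn : HasProjectiveDimensionLE S.X₃ n :=
    (projectiveDimension_le_iff _ n).1 <|
      (projectiveDimension_le_finitisticDimension S.X₃ hC).trans (hM.symm.trans hn).le
  exact (projectiveDimension_ge_iff M n).1 hn.ge (hS.hasProjectiveDimensionLT_X₁ n hlt hCn)

end Ring

section RestrictScalars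

theorem projective_of_isScalarTower (B A Y : Type*) [Ring B] [Ring A] [Module B A]
    [IsScalarTower B A A] [AddCommGroup Y] [Module A Y] [Module B Y] [IsScalarTower B A Y]
    [Module.Projective B A] [Module.Projective A Y] : Module.Projective B Y := by
  obtain ⟨s, hs⟩ := (Module.projective_def' (R := A) (P := Y)).1 ‹_›
  classical
  have : Module.Projective B (Y →₀ A) := .of_equiv (finsuppLequivDFinsupp B).symm
  exact .of_split (s.restrictScalars B)
    ((Finsupp.linearCombination A (id : Y → Y)).restrictScalars B)
    (LinearMap.ext fun y => LinearMap.congr_fun hs y)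

variable {R S : Type w} [Ring R] [Ring S] (f : R →+* S)

theorem shortExact_map_restrictScalars {T : ShortComplex (ModuleCat.{w} S)} (hT : T.ShortExact) :
    (T.map (ModuleCat.restrictScalars f)).ShortExact where
  exact := (ShortComplex.ShortExact.moduleCat_exact_iff_function_exact _).2
    ((ShortComplex.ShortExact.moduleCat_exact_iff_function_exact T).1 hT.exact)
  mono_f := (ModuleCat.mono_iff_injective _).2 hT.moduleCat_injective_f
  epi_g := (ModuleCat.epi_iff_surjective _).2 hT.moduleCat_surjective_g

variable [Module.Projective R ((ModuleCat.restrictScalars f).obj (ModuleCat.of S S))]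

instance : (ModuleCat.restrictScalars.{w} f).PreservesProjectiveObjects where
  projective_obj {M} hM := by
    let := Module.compHom S f
    let := Module.compHom M f
    have : IsScalarTower R S S := ⟨fun r s t => mul_assoc (f r) s t⟩
    have : IsScalarTower R S M := ⟨fun r s m => mul_smul (f r) s m⟩
    have : Module.Projective R S := ‹Module.Projective R (ModuleCat.of S S)›
    rw [← IsProjective.iff_projective] at hM ⊢
    exact projective_of_isScalarTower R S M

theorem projectiveDimension_restrictScalars_obj_le (M : ModuleCat.{w} S) :
    projectiveDimension ((ModuleCat.restrictScalars f).obj M) ≤ projectiveDimension M :=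
  projectiveDimension_obj_le_of_forall_shortExact_map _
    (fun _ => shortExact_map_restrictScalars f) M

end RestrictScalars

section RelTensor

variable {k : Type u} {A : Type w} [Field k] [Ring A] [Algebra k A] {B : Subalgebra k A}

namespace RelTensor

section

variable {M : Type*} [AddCommGroup M] [Module B M] {Y : Type*} [AddCommGroup Y] [Module A Y]

theorem mk_mul_tmul (a : A) (b : B) (m : M) :
    (Submodule.Quotient.mk ((a * (b : A)) ⊗ₜ[ℤ] m) : RelTensor B M) =
      Submodule.Quotient.mk (a ⊗ₜ[ℤ] (b • m)) :=
  (Submodule.Quotient.eq _).2 (Submodule.subset_span ⟨a, b, m, rfl⟩)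

variable (B M) in
/-- The canonical map `M → A ⊗_B M`, `m ↦ 1 ⊗ m`. -/
def unit : M →ₗ[B] RelTensor B M where
  toFun m := Submodule.Quotient.mk ((1 : A) ⊗ₜ[ℤ] m)
  map_add' x y := by rw [TensorProduct.tmul_add, Submodule.Quotient.mk_add]
  map_smul' b m := by
    rw [← mk_mul_tmul, one_mul, RingHom.id_apply, Subalgebra.smul_def,
      ← Submodule.Quotient.mk_smul, TensorProduct.smul_tmul', smul_eq_mul, mul_one]

theorem mk_tmul (a : A) (m : M) :
    (Submodule.Quotient.mk (a ⊗ₜ[ℤ] m) : RelTensor B M) = a • unit B M m := by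
  change _ = a • Submodule.Quotient.mk _
  rw [← Submodule.Quotient.mk_smul, TensorProduct.smul_tmul', smul_eq_mul, mul_one]

variable (B M) in
theorem span_range_unit : Submodule.span A (Set.range (unit B M)) = ⊤ := by
  refine eq_top_iff.2 fun x _ => ?_
  obtain ⟨t, rfl⟩ := Submodule.Quotient.mk_surjective _ x
  induction t with
  | zero => exact zero_mem _
  | tmul a m => exact mk_tmul (B := B) a m ▸ Submodule.smul_mem _ a (Submodule.subset_span ⟨m, rfl⟩)
  | add x y hx hy => exact add_mem (hx trivial) (hy trivial)

theorem hom_ext {f g : RelTensor B M →ₗ[A] Y} (h : ∀ m, f (unit B M m) = g (unit B M m)) :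
    f = g :=
  LinearMap.ext_on_range (span_range_unit B M) h

/-- The `A`-linear extension of a `B`-linear map `M → Y` to `A ⊗_B M`. -/
def lift (f : M →ₗ[B] Y) : RelTensor B M →ₗ[A] Y :=
  Submodule.liftQ (relTensorRel B M)
    (TensorProduct.AlgebraTensorModule.lift
      (LinearMap.toSpanSingleton A (M →ₗ[ℤ] Y) f.toAddMonoidHom.toIntLinearMap)) (by
    refine Submodule.span_le.2 ?_
    rintro _ ⟨a, b, m, rfl⟩
    simp [mul_smul, Subalgebra.smul_def])

@[simp]
theorem lift_unit (f : M →ₗ[B] Y) (m : M) : lift f (unit B M m) = f m :=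
  one_smul A (f m)

@[simp]
theorem map_unit {N : Type*} [AddCommGroup N] [Module B N] (f : M →ₗ[B] N) (m : M) :
    RelTensor.map B f (unit B M m) = unit B N (f m) := rfl

instance finite [Module.Finite B M] : Module.Finite A (RelTensor B M) := by
  obtain ⟨s, hs⟩ := Module.Finite.fg_top (R := B) (M := M)
  classical
  refine ⟨s.image (unit B M), eq_top_iff.2 ?_⟩
  rw [← span_range_unit B M, Submodule.span_le, ← LinearMap.coe_range, ← Submodule.map_top, ← hs,
    LinearMap.map_span, Finset.coe_image]
  exact Submodule.span_subset_span B A _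

instance projective {P : Type w} [AddCommGroup P] [Module B P] [Module.Projective B P] :
    Module.Projective A (RelTensor B P) := by
  refine Module.Projective.of_lifting_property fun {X Y} _ _ _ _ f g hf => ?_
  obtain ⟨h, hh⟩ := Module.projective_lifting_property (f.restrictScalars B)
    (g.restrictScalars B ∘ₗ unit B P) hf
  exact ⟨lift h, hom_ext fun m => by simpa using LinearMap.congr_fun hh m⟩

end

variable (B) in
/-- Induction `M ↦ A ⊗_B M` as a functor from left `B`-modules to left `A`-modules. -/
@[simps]
def functor : ModuleCat.{w} B ⥤ ModuleCat.{w} A where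
  obj M := ModuleCat.of A (RelTensor B M)
  map f := ModuleCat.ofHom (RelTensor.map B f.hom)
  map_id _ := ModuleCat.hom_ext <| hom_ext fun _ => rfl
  map_comp _ _ := ModuleCat.hom_ext <| hom_ext fun _ => rfl

instance : (functor B).PreservesZeroMorphisms where
  map_zero _ N := ModuleCat.hom_ext <| hom_ext fun _ => (unit B N).map_zero

instance : (functor B).PreservesProjectiveObjects where
  projective_obj {M} hM := by
    rw [← IsProjective.iff_projective] at hM
    exact (IsProjective.iff_projective _).1 projective

end RelTensor

namespace IsRightFaithfullyFlat

variable (hflat : IsRightFaithfullyFlat B)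
include hflat

theorem exact_map_functor_iff (S : ShortComplex (ModuleCat.{w} B)) :
    (S.map (RelTensor.functor B)).Exact ↔ S.Exact := by
  simp only [ShortComplex.ShortExact.moduleCat_exact_iff_function_exact]
  exact (hflat _ _ _ _ _).symm

theorem mono_map_functor_iff {M N : ModuleCat.{w} B} (f : M ⟶ N) :
    Mono ((RelTensor.functor B).map f) ↔ Mono f := by
  have h := hflat.exact_map_functor_iff (.mk (0 : ModuleCat.of B PUnit ⟶ M) f Limits.zero_comp)
  rwa [ShortComplex.exact_iff_mono _ ((RelTensor.functor B).map_zero _ _),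
    ShortComplex.exact_iff_mono _ rfl] at h

theorem epi_map_functor_iff {M N : ModuleCat.{w} B} (f : M ⟶ N) :
    Epi ((RelTensor.functor B).map f) ↔ Epi f := by
  have h := hflat.exact_map_functor_iff (.mk f (0 : N ⟶ ModuleCat.of B PUnit) Limits.comp_zero)
  rwa [ShortComplex.exact_iff_epi _ ((RelTensor.functor B).map_zero _ _),
    ShortComplex.exact_iff_epi _ rfl] at h

theorem shortExact_map_functor {S : ShortComplex (ModuleCat.{w} B)} (hS : S.ShortExact) :
    (S.map (RelTensor.functor B)).ShortExact where
  exact := (hflat.exact_map_functor_iff S).2 hS.exact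
  mono_f := (hflat.mono_map_functor_iff _).2 hS.mono_f
  epi_g := (hflat.epi_map_functor_iff _).2 hS.epi_g

theorem injective_unit (M : Type w) [AddCommGroup M] [Module B M] :
    Function.Injective (RelTensor.unit B M) := by
  have hmono : Mono ((RelTensor.functor B).map (ModuleCat.ofHom (RelTensor.unit B M))) := by
    rw [ModuleCat.mono_iff_injective]
    exact Function.LeftInverse.injective (g := RelTensor.lift LinearMap.id) <| LinearMap.congr_fun
      (f := RelTensor.lift LinearMap.id ∘ₗ RelTensor.map B (RelTensor.unit B M))
      (g := LinearMap.id) (RelTensor.hom_ext fun m => by simp)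
  exact (ModuleCat.mono_iff_injective _).1 ((hflat.mono_map_functor_iff _).1 hmono)

theorem projectiveDimension_functor_obj_le (M : ModuleCat.{w} B) :
    projectiveDimension ((RelTensor.functor B).obj M) ≤ projectiveDimension M :=
  projectiveDimension_obj_le_of_forall_shortExact_map _
    (fun _ => hflat.shortExact_map_functor) M

theorem finitisticDimension_le [Module.Finite B A] [Module.Projective B A]
    (hfin : finitisticDimension B < ⊤) : finitisticDimension B ≤ finitisticDimension A := by
  obtain ⟨M, _, hM⟩ := exists_projectiveDimension_eq_finitisticDimension hfin
  let AM := (RelTensor.functor B).obj M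
  have : Module.Finite A AM := inferInstanceAs (Module.Finite A (RelTensor B M))
  let res := ModuleCat.restrictScalars.{w} B.val.toRingHom
  have : Module.Finite B (res.obj AM) := Module.Finite.trans (R := B) (M := RelTensor B M) A
  have : Module.Projective B (res.obj (ModuleCat.of A A)) := ‹Module.Projective B A›
  let η : M ⟶ res.obj AM := ModuleCat.ofHom (RelTensor.unit B M)
  have : Mono η := (ModuleCat.mono_iff_injective η).2 (hflat.injective_unit M)
  have hAM : projectiveDimension AM < ⊤ :=
    (hflat.projectiveDimension_functor_obj_le M).trans_lt (hM ▸ hfin)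
  calc finitisticDimension B = projectiveDimension M := hM.symm
    _ ≤ projectiveDimension (res.obj AM) :=
      projectiveDimension_le_of_mono_of_eq_finitisticDimension η hM hfin
    _ ≤ projectiveDimension AM := projectiveDimension_restrictScalars_obj_le _ AM
    _ ≤ finitisticDimension A := projectiveDimension_le_finitisticDimension AM hAM

end IsRightFaithfullyFlat

end RelTensor

end FinitisticDimension

section Contraction

open TensorProduct

variable {R M N P : Type*} [CommSemiring R] [AddCommMonoid M] [Module R M]
  [AddCommMonoid N] [Module R N] [AddCommMonoid P] [Module R P]

variable (N) in
/-- Evaluation of a functional on the first tensor factor, `m ⊗ n ↦ φ(m)n`. -/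
def contractFst (φ : M →ₗ[R] R) : M ⊗[R] N →ₗ[R] N :=
  (TensorProduct.lid R N).toLinearMap ∘ₗ φ.rTensor N

variable (M) in
/-- Evaluation of a functional on the second tensor factor, `m ⊗ n ↦ φ(n)m`. -/
def contractSnd (φ : N →ₗ[R] R) : M ⊗[R] N →ₗ[R] M :=
  (TensorProduct.rid R M).toLinearMap ∘ₗ φ.lTensor M

@[simp]
theorem contractFst_tmul (φ : M →ₗ[R] R) (m : M) (n : N) :
    contractFst N φ (m ⊗ₜ n) = φ m • n := by
  simp [contractFst]

@[simp]
theorem contractSnd_tmul (φ : N →ₗ[R] R) (m : M) (n : N) :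
    contractSnd M φ (m ⊗ₜ n) = φ n • m := by
  simp [contractSnd]

theorem contractFst_lTensor (φ : M →ₗ[R] R) (f : N →ₗ[R] P) (z : M ⊗[R] N) :
    contractFst P φ (f.lTensor M z) = f (contractFst N φ z) :=
  LinearMap.congr_fun
    (f := contractFst P φ ∘ₗ f.lTensor M) (g := f ∘ₗ contractFst N φ) (by ext; simp) z

theorem contractSnd_rTensor (φ : N →ₗ[R] R) (f : M →ₗ[R] P) (z : M ⊗[R] N) :
    contractSnd P φ (f.rTensor N z) = f (contractSnd M φ z) :=
  LinearMap.congr_fun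
    (f := contractSnd P φ ∘ₗ f.rTensor N) (g := f ∘ₗ contractSnd M φ) (by ext; simp) z

theorem contractFst_rTensor (φ : P →ₗ[R] R) (f : M →ₗ[R] P) (z : M ⊗[R] N) :
    contractFst N φ (f.rTensor N z) = contractFst N (φ ∘ₗ f) z := by
  simp only [contractFst, LinearMap.comp_apply, LinearMap.rTensor_comp_apply]

theorem contractFst_assoc (φ : M →ₗ[R] R) (z : (M ⊗[R] N) ⊗[R] P) :
    contractFst (N ⊗[R] P) φ (TensorProduct.assoc R M N P z) = (contractFst N φ).rTensor P z :=
  LinearMap.congr_fun (f := contractFst (N ⊗[R] P) φ ∘ₗ (TensorProduct.assoc R M N P).toLinearMap)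
    (g := (contractFst N φ).rTensor P) (by ext; simp [TensorProduct.smul_tmul']) z

theorem contractSnd_assoc (φ : P →ₗ[R] R) (z : (M ⊗[R] N) ⊗[R] P) :
    (contractSnd N φ).lTensor M (TensorProduct.assoc R M N P z) = contractSnd (M ⊗[R] N) φ z :=
  LinearMap.congr_fun (f := (contractSnd N φ).lTensor M ∘ₗ
      (TensorProduct.assoc R M N P).toLinearMap)
    (g := contractSnd (M ⊗[R] N) φ) (by ext; simp) z

theorem apply_contractFst (θ : M →ₗ[R] R) (φ : N →ₗ[R] R) (z : M ⊗[R] N) :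
    φ (contractFst N θ z) = θ (contractSnd M φ z) :=
  LinearMap.congr_fun (f := φ ∘ₗ contractFst N θ) (g := θ ∘ₗ contractSnd M φ)
    (by ext; simp [mul_comm]) z

variable {A B : Type*} [Semiring A] [Algebra R A] [Semiring B] [Algebra R B]

theorem contractFst_mul_one_tmul (θ : A →ₗ[R] R) (z : A ⊗[R] B) (b : B) :
    contractFst B θ (z * (1 ⊗ₜ b)) = contractFst B θ z * b :=
  LinearMap.congr_fun (f := contractFst B θ ∘ₗ LinearMap.mulRight R (1 ⊗ₜ b))
    (g := LinearMap.mulRight R b ∘ₗ contractFst B θ) (by ext; simp) z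

theorem contractFst_mul_tmul_one (θ : A →ₗ[R] R) (z : A ⊗[R] B) (a : A) :
    contractFst B θ (z * (a ⊗ₜ 1)) = contractFst B (θ ∘ₗ LinearMap.mulRight R a) z :=
  LinearMap.congr_fun (f := contractFst B θ ∘ₗ LinearMap.mulRight R (a ⊗ₜ 1))
    (g := contractFst B (θ ∘ₗ LinearMap.mulRight R a)) (by ext; simp) z

theorem contractSnd_mul_one_tmul (φ : B →ₗ[R] R) (z : A ⊗[R] B) (b : B) :
    contractSnd A φ (z * (1 ⊗ₜ b)) = contractSnd A (φ ∘ₗ LinearMap.mulRight R b) z :=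
  LinearMap.congr_fun (f := contractSnd A φ ∘ₗ LinearMap.mulRight R (1 ⊗ₜ b))
    (g := contractSnd A (φ ∘ₗ LinearMap.mulRight R b)) (by ext; simp) z

theorem contractSnd_mul_tmul_one (φ : B →ₗ[R] R) (z : A ⊗[R] B) (a : A) :
    contractSnd A φ (z * (a ⊗ₜ 1)) = contractSnd A φ z * a :=
  LinearMap.congr_fun (f := contractSnd A φ ∘ₗ LinearMap.mulRight R (a ⊗ₜ 1))
    (g := LinearMap.mulRight R a ∘ₗ contractSnd A φ) (by ext; simp) z

end Contraction

section Hit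

open Coalgebra

variable {R C : Type*} [CommSemiring R] [AddCommMonoid C] [Module R C] [Coalgebra R C]

/-- The right action `c ↼ θ = θ(c₁)c₂` of the dual of a coalgebra on the coalgebra. -/
def rightHit (θ : C →ₗ[R] R) : C →ₗ[R] C := contractFst C θ ∘ₗ comul

/-- The left action `φ ⇀ c = c₁φ(c₂)` of the dual of a coalgebra on the coalgebra. -/
def leftHit (φ : C →ₗ[R] R) : C →ₗ[R] C := contractSnd C φ ∘ₗ comul

theorem rightHit_apply (θ : C →ₗ[R] R) (c : C) : rightHit θ c = contractFst C θ (comul c) := rfl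

theorem leftHit_apply (φ : C →ₗ[R] R) (c : C) : leftHit φ c = contractSnd C φ (comul c) := rfl

theorem rightHit_counit (c : C) : rightHit (counit (R := R) (A := C)) c = c := by
  simp [rightHit_apply, contractFst]

theorem leftHit_counit (c : C) : leftHit (counit (R := R) (A := C)) c = c := by
  simp [leftHit_apply, contractSnd]

theorem comul_rightHit (θ : C →ₗ[R] R) (c : C) :
    comul (R := R) (rightHit θ c) = (rightHit θ).rTensor C (comul c) := by
  rw [rightHit_apply, ← contractFst_lTensor, ← coassoc_apply, contractFst_assoc,
    ← LinearMap.rTensor_comp_apply, rightHit]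

theorem comul_leftHit (φ : C →ₗ[R] R) (c : C) :
    comul (R := R) (leftHit φ c) = (leftHit φ).lTensor C (comul c) := by
  rw [leftHit_apply, ← contractSnd_rTensor, ← contractSnd_assoc, coassoc_apply,
    ← LinearMap.lTensor_comp_apply, leftHit]

theorem rightHit_rightHit (α β : C →ₗ[R] R) (c : C) :
    rightHit α (rightHit β c) = rightHit (α ∘ₗ rightHit β) c := by
  rw [rightHit_apply, comul_rightHit, contractFst_rTensor, rightHit_apply]

theorem rightHit_leftHit (θ φ : C →ₗ[R] R) (c : C) :
    rightHit θ (leftHit φ c) = leftHit φ (rightHit θ c) := by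
  rw [rightHit_apply, comul_leftHit, contractFst_lTensor, rightHit_apply]

theorem apply_leftHit (θ φ : C →ₗ[R] R) (c : C) : θ (leftHit φ c) = φ (rightHit θ c) :=
  (apply_contractFst θ φ _).symm

end Hit

section WeakBialgebra

open Coalgebra TensorProduct

variable {k : Type u} {H : Type v} [Field k] [Ring H] [Algebra k H] [Coalgebra k H]

local notation "Δ" => Coalgebra.comul (R := k) (A := H)
local notation "ε" => Coalgebra.counit (R := k) (A := H)

theorem targetMap_eq_contractFst (h : H) :
    targetMap k H h = contractFst H (ε ∘ₗ LinearMap.mulRight k h) (Δ 1) := rfl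

theorem sourceMap_eq_contractSnd (h : H) :
    sourceMap k H h = contractSnd H (ε ∘ₗ LinearMap.mulLeft k h) (Δ 1) := rfl

theorem targetMap_eq_sum {ι : Type*} (r : Coalgebra.Repr k (1 : H) ι) (h : H) :
    targetMap k H h = ∑ i ∈ r.index, ε (r.left i * h) • r.right i := by
  simp [targetMap, ← r.eq]

theorem sourceMap_eq_sum {ι : Type*} (r : Coalgebra.Repr k (1 : H) ι) (h : H) :
    sourceMap k H h = ∑ i ∈ r.index, ε (h * r.right i) • r.left i := by
  simp [sourceMap, ← r.eq]

theorem targetMap_one : targetMap k H 1 = 1 := by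
  simp [targetMap]

theorem sourceMap_one : sourceMap k H 1 = 1 := by
  simp [sourceMap]

theorem lTensor_targetMap_of_multiplicative {A : Type w} [Ring A] [Algebra k A]
    (ρ : A →ₗ[k] A ⊗[k] H) (hmul : ∀ a b, ρ (a * b) = ρ a * ρ b)
    (hcounit : ∀ a, contractSnd A ε (ρ a) = a)
    (hone : ρ.rTensor H (ρ 1) = (TensorProduct.assoc k A H H).symm ((1 : A) ⊗ₜ[k] Δ 1) *
      (ρ 1 ⊗ₜ[k] (1 : H))) (a : A) :
    (targetMap k H).lTensor A (ρ a) = ρ 1 * (a ⊗ₜ[k] (1 : H)) := by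
  have r := Coalgebra.Repr.arbitrary k (1 : H)
  have hid : contractSnd A ε ∘ₗ ρ = LinearMap.id := LinearMap.ext hcounit
  have hρmul (x y : A ⊗[k] H) : ρ.rTensor H (x * y) = ρ.rTensor H x * ρ.rTensor H y :=
    LinearMap.map_mul_of_map_mul_tmul (by simp [hmul]) x y
  have htarget (z : A ⊗[k] H) : (contractSnd A ε).rTensor H
      ((TensorProduct.assoc k A H H).symm ((1 : A) ⊗ₜ[k] Δ 1) * (z ⊗ₜ[k] (1 : H))) =
        (targetMap k H).lTensor A z := by
    induction z with
    | zero => simp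
    | tmul b h => simp [← r.eq, targetMap_eq_sum r, tmul_sum, Finset.sum_mul, smul_tmul]
    | add x y hx hy => simp only [add_tmul, mul_add, map_add, hx, hy]
  symm
  calc ρ 1 * (a ⊗ₜ[k] (1 : H))
      = (contractSnd A ε).rTensor H (ρ.rTensor H (ρ 1 * (a ⊗ₜ[k] (1 : H)))) := by
        rw [← LinearMap.rTensor_comp_apply, hid, LinearMap.rTensor_id_apply]
    _ = (contractSnd A ε).rTensor H ((TensorProduct.assoc k A H H).symm ((1 : A) ⊗ₜ[k] Δ 1) *
          (ρ a ⊗ₜ[k] (1 : H))) := by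
        rw [hρmul, hone, LinearMap.rTensor_tmul, mul_assoc, Algebra.TensorProduct.tmul_mul_tmul,
          ← hmul, one_mul, one_mul]
    _ = (targetMap k H).lTensor A (ρ a) := htarget (ρ a)

namespace WeakBialgebra

variable [WeakBialgebra k H]

theorem comul_mul_comul_one (h : H) : Δ h * Δ 1 = Δ h := by
  rw [← comul_mul, mul_one]

theorem comul_one_mul_comul (h : H) : Δ 1 * Δ h = Δ h := by
  rw [← comul_mul, one_mul]

theorem comul_targetMap (h : H) : Δ (targetMap k H h) = Δ 1 * (targetMap k H h ⊗ₜ[k] (1 : H)) := by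
  have r := Coalgebra.Repr.arbitrary k (1 : H)
  conv_lhs => rw [targetMap_eq_contractFst, ← contractFst_lTensor, comul_comul_one']
  simp [targetMap_eq_sum r, ← r.eq, sum_tmul, tmul_sum, Finset.sum_mul_sum, smul_tmul']

theorem comul_sourceMap (h : H) : Δ (sourceMap k H h) = ((1 : H) ⊗ₜ[k] sourceMap k H h) * Δ 1 := by
  have r := Coalgebra.Repr.arbitrary k (1 : H)
  conv_lhs => rw [sourceMap_eq_contractSnd, ← contractSnd_rTensor, ← contractSnd_assoc,
    coassoc_apply, comul_comul_one']
  simp [sourceMap_eq_sum r, ← r.eq, sum_tmul, tmul_sum, Finset.sum_mul_sum]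

theorem sourceMap_mul_targetMap (g h : H) :
    sourceMap k H g * targetMap k H h = targetMap k H h * sourceMap k H g := by
  have r := Coalgebra.Repr.arbitrary k (1 : H)
  have key := congrArg (contractFst H (ε ∘ₗ LinearMap.mulRight k h) ∘ₗ
    (contractSnd H (ε ∘ₗ LinearMap.mulLeft k g)).lTensor H)
    ((comul_comul_one (k := k) (H := H)).symm.trans comul_comul_one')
  rw [targetMap_eq_sum r, sourceMap_eq_sum r]
  simpa [← r.eq, sum_tmul, tmul_sum, Finset.sum_mul_sum, smul_smul, mul_comm] using key.symm

theorem counit_mul_eq_sum {ι : Type*} (r : Coalgebra.Repr k (1 : H) ι) (h g : H) :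
    ε (h * g) = ∑ i ∈ r.index, ε (r.left i * g) * ε (h * r.right i) := by
  simpa [← r.eq] using counit_mul_mul' (k := k) h 1 g

theorem counit_sourceMap_mul (h g : H) : ε (sourceMap k H h * g) = ε (h * g) := by
  have r := Coalgebra.Repr.arbitrary k (1 : H)
  simp [counit_mul_eq_sum r h g, sourceMap_eq_sum r, Finset.sum_mul, mul_comm]

theorem counit_mul_targetMap (h g : H) : ε (h * targetMap k H g) = ε (h * g) := by
  have r := Coalgebra.Repr.arbitrary k (1 : H)
  simp [counit_mul_eq_sum r h g, targetMap_eq_sum r, Finset.mul_sum]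

theorem sourceMap_sourceMap_mul (h g : H) :
    sourceMap k H (sourceMap k H h * g) = sourceMap k H (h * g) := by
  have r := Coalgebra.Repr.arbitrary k (1 : H)
  simp only [sourceMap_eq_sum r (_ * g), mul_assoc, counit_sourceMap_mul]

theorem targetMap_mul_targetMap (h g : H) :
    targetMap k H (h * targetMap k H g) = targetMap k H (h * g) := by
  have r := Coalgebra.Repr.arbitrary k (1 : H)
  simp only [targetMap_eq_sum r (h * _), ← mul_assoc, counit_mul_targetMap]

theorem lTensor_targetMap_comul (h : H) :
    (targetMap k H).lTensor H (Δ h) = Δ 1 * (h ⊗ₜ[k] (1 : H)) := by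
  have r := Coalgebra.Repr.arbitrary k (1 : H)
  refine lTensor_targetMap_of_multiplicative Δ comul_mul (by simp [contractSnd]) ?_ h
  rw [← coassoc_symm_apply, comul_comul_one']
  simp [← r.eq, sum_tmul, tmul_sum, Finset.sum_mul_sum]

theorem rTensor_sourceMap_comul (h : H) :
    (sourceMap k H).rTensor H (Δ h) = ((1 : H) ⊗ₜ[k] h) * Δ 1 := by
  have r := Coalgebra.Repr.arbitrary k (1 : H)
  have hid : contractFst H ε ∘ₗ Δ = LinearMap.id := by ext; simp [contractFst]
  have hmul (x y : H ⊗[k] H) : (Δ).lTensor H (x * y) = (Δ).lTensor H x * (Δ).lTensor H y :=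
    LinearMap.map_mul_of_map_mul_tmul (by simp [comul_mul]) x y
  have hsource (z : H ⊗[k] H) : (contractFst H ε).lTensor H
      (((1 : H) ⊗ₜ[k] z) * TensorProduct.assoc k H H H (Δ 1 ⊗ₜ[k] (1 : H))) =
        (sourceMap k H).rTensor H z := by
    induction z with
    | zero => simp
    | tmul b h => simp [← r.eq, sourceMap_eq_sum r, sum_tmul, Finset.mul_sum, smul_tmul]
    | add x y hx hy => simp only [tmul_add, add_mul, map_add, hx, hy]
  symm
  calc ((1 : H) ⊗ₜ[k] h) * Δ 1
      = (contractFst H ε).lTensor H ((Δ).lTensor H (((1 : H) ⊗ₜ[k] h) * Δ 1)) := by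
        rw [← LinearMap.lTensor_comp_apply, hid, LinearMap.lTensor_id_apply]
    _ = (contractFst H ε).lTensor H
          (((1 : H) ⊗ₜ[k] Δ h) * TensorProduct.assoc k H H H (Δ 1 ⊗ₜ[k] (1 : H))) := by
        rw [hmul, comul_comul_one', LinearMap.lTensor_tmul, ← mul_assoc,
          Algebra.TensorProduct.tmul_mul_tmul, comul_mul_comul_one, mul_one]
    _ = (sourceMap k H).rTensor H (Δ h) := hsource (Δ h)

theorem counit_mul_mul_eq_counit_rightHit_mul (a p b : H) :
    ε (a * p * b) = ε (rightHit (ε ∘ₗ LinearMap.mulLeft k a) p * b) := by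
  have s := Coalgebra.Repr.arbitrary k p
  simp [counit_mul_mul, rightHit_apply, ← s.eq, Finset.sum_mul]

theorem rightHit_counit_mulLeft (a x : H) :
    rightHit (ε ∘ₗ LinearMap.mulLeft k a) x = rightHit (ε ∘ₗ LinearMap.mulLeft k a) 1 * x := by
  set g := rightHit (ε ∘ₗ LinearMap.mulLeft k a) with hg
  have hcontract (z w : H ⊗[k] H) : contractFst H (ε ∘ₗ LinearMap.mulLeft k a) (z * w) =
      contractFst H ε (g.rTensor H z * w) := by
    induction z with
    | zero => simp
    | add y z hy hz => simp only [add_mul, map_add, hy, hz]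
    | tmul p q =>
      induction w with
      | zero => simp
      | add y z hy hz => simp only [mul_add, map_add, hy, hz]
      | tmul b c => simp [← mul_assoc, counit_mul_mul_eq_counit_rightHit_mul, hg]
  calc g x = contractFst H (ε ∘ₗ LinearMap.mulLeft k a) (Δ 1 * Δ x) := by
        rw [comul_one_mul_comul, hg, rightHit_apply]
    _ = contractFst H ε (Δ (g 1 * x)) := by rw [hcontract, ← comul_rightHit, comul_mul]
    _ = g 1 * x := rightHit_counit _

theorem rTensor_targetMap_comul (x : H) :
    (targetMap k H).rTensor H (Δ x) = (targetMap k H).rTensor H (Δ 1) * ((1 : H) ⊗ₜ[k] x) := by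
  have r := Coalgebra.Repr.arbitrary k (1 : H)
  have hsum (y : H) : (targetMap k H).rTensor H (Δ y) =
      ∑ i ∈ r.index, r.right i ⊗ₜ[k] rightHit (ε ∘ₗ LinearMap.mulLeft k (r.left i)) y := by
    have s := Coalgebra.Repr.arbitrary k y
    simp only [rightHit_apply, ← s.eq]
    simp [targetMap_eq_sum r, sum_tmul, tmul_sum, smul_tmul, Finset.sum_comm (s := s.index)]
  rw [hsum, hsum, Finset.sum_mul]
  simp [rightHit_counit_mulLeft _ x]

theorem map_sourceMap_targetMap_comul (h : H) :
    map (sourceMap k H) (targetMap k H) (Δ h) =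
      TensorProduct.comm k H H (map (targetMap k H) (sourceMap k H) (Δ h)) := by
  have r := Coalgebra.Repr.arbitrary k (1 : H)
  have s := Coalgebra.Repr.arbitrary k h
  have hcounit (a b : H) : ε (a * h * b) = ∑ l ∈ s.index, ε (a * s.left l) * ε (s.right l * b) := by
    simp [counit_mul_mul, ← s.eq]
  calc map (sourceMap k H) (targetMap k H) (Δ h)
      = (targetMap k H).lTensor H (((1 : H) ⊗ₜ[k] h) * Δ 1) := by
        rw [← rTensor_sourceMap_comul, ← LinearMap.comp_apply (LinearMap.lTensor _ _),
          LinearMap.lTensor_comp_rTensor]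
    _ = ∑ i ∈ r.index, ∑ j ∈ r.index, ε (r.left j * h * r.right i) • r.left i ⊗ₜ r.right j := by
        rw [← r.eq]
        simp [Finset.mul_sum, targetMap_eq_sum r, tmul_sum, mul_assoc]
    _ = TensorProduct.comm k H H (map (targetMap k H) (sourceMap k H) (Δ h)) := by
        rw [← s.eq]
        simp only [map_sum, TensorProduct.map_tmul, targetMap_eq_sum r, sourceMap_eq_sum r, hcounit,
          Finset.sum_smul, sum_tmul, tmul_sum, smul_tmul_smul, map_smul, comm_tmul,
          Finset.sum_comm (s := s.index)]

end WeakBialgebra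

end WeakBialgebra

section Convolution

open Coalgebra TensorProduct WithConv

-- Both `y` and `b' * a'` are generalized inverses of `a * b` with the same one-sided products.
theorem eq_mul_of_generalizedInverse {G : Type*} [Semigroup G] {a a' b b' y : G}
    (hy : y * (a * b) * y = y) (ha : a' * a * a' = a') (hb : b' * b * b' = b')
    (hcomm : Commute (a' * a) (b * b')) (hl : y * (a * b) = b' * (a' * a * b))
    (hr : a * b * y = a * (b * b' * a')) : y = b' * a' :=
  calc y = b' * (a' * a * b) * y := by rw [← hl, hy]
    _ = b' * a' * (a * b * y) := by simp only [mul_assoc]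
    _ = b' * ((a' * a) * (b * b')) * a' := by rw [hr]; simp only [mul_assoc]
    _ = (b' * b * b') * (a' * a * a') := by rw [hcomm.eq]; simp only [mul_assoc]
    _ = b' * a' := by rw [ha, hb]

variable {R C D A B : Type*} [CommSemiring R]
  [AddCommMonoid C] [Module R C] [Coalgebra R C] [AddCommMonoid D] [Module R D] [Coalgebra R D]
  [Semiring A] [Algebra R A] [Semiring B] [Algebra R B]

theorem sum_counit_right_smul {c : C} {ι : Type*} (r : Coalgebra.Repr R c ι) :
    ∑ i ∈ r.index, counit (R := R) (r.right i) • r.left i = c := by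
  simpa [leftHit_apply, ← r.eq] using leftHit_counit (R := R) c

variable (D) in
/-- The map `c ⊗ d ↦ f(c)ε(d)`, as an element of the convolution algebra of `C ⊗ D`. -/
def convFst (f : WithConv (C →ₗ[R] A)) : WithConv (C ⊗[R] D →ₗ[R] A) :=
  toConv (f.ofConv ∘ₗ contractSnd C counit)

variable (C) in
/-- The map `c ⊗ d ↦ ε(c)f(d)`, as an element of the convolution algebra of `C ⊗ D`. -/
def convSnd (f : WithConv (D →ₗ[R] A)) : WithConv (C ⊗[R] D →ₗ[R] A) :=
  toConv (f.ofConv ∘ₗ contractFst D counit)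

omit [Coalgebra R C] in
@[simp]
theorem convFst_tmul (f : WithConv (C →ₗ[R] A)) (c : C) (d : D) :
    (convFst D f) (c ⊗ₜ[R] d) = counit (R := R) d • f c := by
  simp [convFst]

omit [Coalgebra R D] in
@[simp]
theorem convSnd_tmul (f : WithConv (D →ₗ[R] A)) (c : C) (d : D) :
    (convSnd C f) (c ⊗ₜ[R] d) = counit (R := R) c • f d := by
  simp [convSnd]

theorem convFst_mul (f g : WithConv (C →ₗ[R] A)) :
    convFst D (f * g) = convFst D f * convFst D g :=
  WithConv.ext (LinearMap.convMul_comp_coalgHom_distrib f g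
    ((Coalgebra.TensorProduct.rid R R C).toCoalgHom.comp
      (Coalgebra.TensorProduct.map (CoalgHom.id R C) (counitCoalgHom R D))))

theorem convSnd_mul (f g : WithConv (D →ₗ[R] A)) :
    convSnd C (f * g) = convSnd C f * convSnd C g :=
  WithConv.ext (LinearMap.convMul_comp_coalgHom_distrib f g
    ((Coalgebra.TensorProduct.lid R D).toCoalgHom.comp
      (Coalgebra.TensorProduct.map (counitCoalgHom R C) (CoalgHom.id R D))))

theorem convFst_mul_apply (f : WithConv (C →ₗ[R] A)) (g : WithConv (C ⊗[R] D →ₗ[R] A))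
    {c : C} {ι : Type*} (r : Coalgebra.Repr R c ι) (d : D) :
    (convFst D f * g) (c ⊗ₜ[R] d) = ∑ i ∈ r.index, f (r.left i) * g (r.right i ⊗ₜ[R] d) := by
  have s := Coalgebra.Repr.arbitrary R d
  conv_rhs => rw [← Coalgebra.sum_counit_smul s]
  simp [TensorProduct.comul_tmul, ← r.eq, ← s.eq, sum_tmul, tmul_sum, Finset.mul_sum,
    Finset.sum_comm (s := r.index)]

theorem convSnd_mul_apply (f : WithConv (D →ₗ[R] A)) (g : WithConv (C ⊗[R] D →ₗ[R] A))
    (c : C) {d : D} {ι : Type*} (s : Coalgebra.Repr R d ι) :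
    (convSnd C f * g) (c ⊗ₜ[R] d) = ∑ j ∈ s.index, f (s.left j) * g (c ⊗ₜ[R] s.right j) := by
  have r := Coalgebra.Repr.arbitrary R c
  conv_rhs => rw [← Coalgebra.sum_counit_smul r]
  simp [TensorProduct.comul_tmul, ← r.eq, ← s.eq, sum_tmul, tmul_sum, Finset.mul_sum, ← smul_tmul']

theorem convFst_mul_convSnd_apply (f : WithConv (C →ₗ[R] A)) (g : WithConv (D →ₗ[R] A))
    (c : C) (d : D) : (convFst D f * convSnd C g) (c ⊗ₜ[R] d) = f c * g d := by
  have r := Coalgebra.Repr.arbitrary R c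
  rw [convFst_mul_apply f _ r]
  conv_rhs => rw [← sum_counit_right_smul r]
  simp [Finset.sum_mul]

theorem convSnd_mul_convFst_apply (f : WithConv (D →ₗ[R] A)) (g : WithConv (C →ₗ[R] A))
    (c : C) (d : D) : (convSnd C f * convFst D g) (c ⊗ₜ[R] d) = f d * g c := by
  have s := Coalgebra.Repr.arbitrary R d
  rw [convSnd_mul_apply f _ c s]
  conv_rhs => rw [← sum_counit_right_smul s]
  simp [Finset.sum_mul]

variable (B) in
/-- The map `c ↦ f(c) ⊗ 1`, as an element of the convolution algebra. -/
def convInl (f : WithConv (C →ₗ[R] A)) : WithConv (C →ₗ[R] A ⊗[R] B) :=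
  toConv ((Algebra.TensorProduct.includeLeft : A →ₐ[R] A ⊗[R] B).toLinearMap ∘ₗ f.ofConv)

variable (A) in
/-- The map `c ↦ 1 ⊗ f(c)`, as an element of the convolution algebra. -/
def convInr (f : WithConv (C →ₗ[R] B)) : WithConv (C →ₗ[R] A ⊗[R] B) :=
  toConv ((Algebra.TensorProduct.includeRight : B →ₐ[R] A ⊗[R] B).toLinearMap ∘ₗ f.ofConv)

omit [Coalgebra R C] in
@[simp]
theorem convInl_apply (f : WithConv (C →ₗ[R] A)) (c : C) : convInl B f c = f c ⊗ₜ[R] 1 := rfl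

omit [Coalgebra R C] in
@[simp]
theorem convInr_apply (f : WithConv (C →ₗ[R] B)) (c : C) : convInr A f c = 1 ⊗ₜ[R] f c := rfl

theorem convInl_mul (f g : WithConv (C →ₗ[R] A)) :
    convInl B (f * g) = convInl B f * convInl B g :=
  WithConv.ext (LinearMap.algHom_comp_convMul_distrib _ f g)

theorem convInr_mul (f g : WithConv (C →ₗ[R] B)) :
    convInr A (f * g) = convInr A f * convInr A g :=
  WithConv.ext (LinearMap.algHom_comp_convMul_distrib _ f g)

theorem convInl_mul_convInr_apply (f : WithConv (C →ₗ[R] A)) (g : WithConv (C →ₗ[R] B)) (c : C) :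
    (convInl B f * convInr A g) c = map f.ofConv g.ofConv (comul c) := by
  have r := Coalgebra.Repr.arbitrary R c
  simp [r.convMul_apply, ← r.eq]

theorem convInr_mul_convInl_apply (f : WithConv (C →ₗ[R] A)) (g : WithConv (C →ₗ[R] B)) (c : C) :
    (convInr A g * convInl B f) c = TensorProduct.comm R B A (map g.ofConv f.ofConv (comul c)) := by
  have r := Coalgebra.Repr.arbitrary R c
  simp [r.convMul_apply, ← r.eq]

end Convolution

section WeakHopfAlgebra

open Coalgebra TensorProduct WithConv

variable {k : Type u} {H : Type v} [Field k] [Ring H] [Algebra k H] [Coalgebra k H]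

local notation "Δ" => Coalgebra.comul (R := k) (A := H)
local notation "𝒮" => WeakHopfAlgebra.antipode (k := k) (H := H)

namespace WeakBialgebra

variable [WeakBialgebra k H]

theorem toConv_comp_mul'_mul (f g : WithConv (H →ₗ[k] H)) :
    toConv (f.ofConv ∘ₗ LinearMap.mul' k H) * toConv (g.ofConv ∘ₗ LinearMap.mul' k H) =
      toConv ((f * g).ofConv ∘ₗ LinearMap.mul' k H) := by
  refine WithConv.ext (TensorProduct.ext' fun x y => ?_)
  have r := Coalgebra.Repr.arbitrary k x
  have s := Coalgebra.Repr.arbitrary k y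
  simp [TensorProduct.comul_tmul, comul_mul, ← r.eq, ← s.eq, sum_tmul, tmul_sum,
    Finset.sum_mul_sum, Finset.sum_comm (s := r.index)]

theorem toConv_comul_comp_mul (f g : WithConv (H →ₗ[k] H)) :
    toConv (Δ ∘ₗ f.ofConv) * toConv (Δ ∘ₗ g.ofConv) = toConv (Δ ∘ₗ (f * g).ofConv) := by
  refine WithConv.ext (LinearMap.ext fun h => ?_)
  have r := Coalgebra.Repr.arbitrary k h
  simp [← r.eq, comul_mul]

end WeakBialgebra

namespace WeakHopfAlgebra

open WeakBialgebra

variable [WeakHopfAlgebra k H]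

theorem toConv_antipode_mul_id : toConv 𝒮 * toConv LinearMap.id = toConv (sourceMap k H) :=
  congrArg toConv antipode_conv_id

theorem toConv_id_mul_antipode : toConv LinearMap.id * toConv 𝒮 = toConv (targetMap k H) :=
  congrArg toConv id_conv_antipode

theorem toConv_antipode_mul_id_mul_antipode :
    toConv 𝒮 * toConv LinearMap.id * toConv 𝒮 = toConv 𝒮 :=
  congrArg toConv antipode_conv_id_conv_antipode

theorem sum_antipode_mul {h : H} {ι : Type*} (r : Coalgebra.Repr k h ι) :
    ∑ i ∈ r.index, 𝒮 (r.left i) * r.right i = sourceMap k H h := by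
  simpa [convolution, ← r.eq] using LinearMap.congr_fun (antipode_conv_id (k := k)) h

theorem sum_mul_antipode {h : H} {ι : Type*} (r : Coalgebra.Repr k h ι) :
    ∑ i ∈ r.index, r.left i * 𝒮 (r.right i) = targetMap k H h := by
  simpa [convolution, ← r.eq] using LinearMap.congr_fun (id_conv_antipode (k := k)) h

theorem sum_antipode_mul_sourceMap_mul (h : H) {g : H} {ι : Type*} (r : Coalgebra.Repr k g ι) :
    ∑ i ∈ r.index, 𝒮 (r.left i) * (sourceMap k H h * r.right i) = sourceMap k H (h * g) := by
  have hcomul : Δ (sourceMap k H h * g) = ((1 : H) ⊗ₜ[k] sourceMap k H h) * Δ g := by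
    rw [comul_mul, comul_sourceMap, mul_assoc, comul_one_mul_comul]
  have hsource := LinearMap.congr_fun (antipode_conv_id (k := k)) (sourceMap k H h * g)
  rw [sourceMap_sourceMap_mul] at hsource
  simpa [convolution, hcomul, ← r.eq, Finset.mul_sum] using hsource

theorem sum_mul_targetMap_mul_antipode {h : H} {ι : Type*} (r : Coalgebra.Repr k h ι) (g : H) :
    ∑ i ∈ r.index, r.left i * (targetMap k H g * 𝒮 (r.right i)) = targetMap k H (h * g) := by
  have hcomul : Δ (h * targetMap k H g) = Δ h * (targetMap k H g ⊗ₜ[k] (1 : H)) := by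
    rw [comul_mul, comul_targetMap, ← mul_assoc, comul_mul_comul_one]
  have htarget := LinearMap.congr_fun (id_conv_antipode (k := k)) (h * targetMap k H g)
  rw [targetMap_mul_targetMap] at htarget
  simpa [convolution, hcomul, ← r.eq, Finset.sum_mul, mul_assoc] using htarget

theorem toConv_antipode_comp_mul' :
    toConv (𝒮 ∘ₗ LinearMap.mul' k H) = convSnd H (toConv 𝒮) * convFst H (toConv 𝒮) := by
  have hmul : convFst H (toConv LinearMap.id) * convSnd H (toConv LinearMap.id) =
      toConv ((toConv LinearMap.id).ofConv ∘ₗ LinearMap.mul' k H) :=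
    WithConv.ext (TensorProduct.ext' fun x y => convFst_mul_convSnd_apply _ _ x y)
  have hy := toConv_comp_mul'_mul (toConv 𝒮) (toConv LinearMap.id)
  have hy' := toConv_comp_mul'_mul (toConv LinearMap.id) (toConv 𝒮)
  apply eq_mul_of_generalizedInverse (a := convFst H (toConv LinearMap.id))
    (b := convSnd H (toConv LinearMap.id))
  · rw [hmul, hy, toConv_comp_mul'_mul, toConv_antipode_mul_id_mul_antipode]
  · rw [← convFst_mul, ← convFst_mul, toConv_antipode_mul_id_mul_antipode]
  · rw [← convSnd_mul, ← convSnd_mul, toConv_antipode_mul_id_mul_antipode]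
  · rw [← convFst_mul, ← convSnd_mul, toConv_antipode_mul_id, toConv_id_mul_antipode]
    refine WithConv.ext (TensorProduct.ext' fun x y => ?_)
    exact (convFst_mul_convSnd_apply _ _ x y).trans ((sourceMap_mul_targetMap x y).trans
      (convSnd_mul_convFst_apply _ _ x y).symm)
  · rw [hmul, hy, ← convFst_mul, toConv_antipode_mul_id]
    refine WithConv.ext (TensorProduct.ext' fun x y => ?_)
    have s := Coalgebra.Repr.arbitrary k y
    rw [convSnd_mul_apply _ _ x s]
    simp only [convFst_mul_convSnd_apply]
    exact (sum_antipode_mul_sourceMap_mul x s).symm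
  · rw [hmul, hy', ← convSnd_mul, toConv_id_mul_antipode]
    refine WithConv.ext (TensorProduct.ext' fun x y => ?_)
    have r := Coalgebra.Repr.arbitrary k x
    rw [convFst_mul_apply _ _ r]
    simp only [convSnd_mul_convFst_apply]
    exact (sum_mul_targetMap_mul_antipode r y).symm

theorem antipode_mul (h g : H) : 𝒮 (h * g) = 𝒮 g * 𝒮 h :=
  (LinearMap.congr_fun (congrArg ofConv toConv_antipode_comp_mul') (h ⊗ₜ[k] g)).trans
    (convSnd_mul_convFst_apply _ _ h g)

theorem toConv_comul_comp_antipode :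
    toConv (Δ ∘ₗ 𝒮) = convInr H (toConv 𝒮) * convInl H (toConv 𝒮) := by
  have hcomul : convInl H (toConv LinearMap.id) * convInr H (toConv LinearMap.id) =
      toConv (Δ ∘ₗ (toConv LinearMap.id).ofConv) :=
    WithConv.ext (LinearMap.ext fun x => by rw [convInl_mul_convInr_apply]; simp)
  have hy := toConv_comul_comp_mul (toConv 𝒮) (toConv LinearMap.id)
  have hy' := toConv_comul_comp_mul (toConv LinearMap.id) (toConv 𝒮)
  apply eq_mul_of_generalizedInverse (a := convInl H (toConv LinearMap.id))
    (b := convInr H (toConv LinearMap.id))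
  · rw [hcomul, hy, toConv_comul_comp_mul, toConv_antipode_mul_id_mul_antipode]
  · rw [← convInl_mul, ← convInl_mul, toConv_antipode_mul_id_mul_antipode]
  · rw [← convInr_mul, ← convInr_mul, toConv_antipode_mul_id_mul_antipode]
  · rw [← convInl_mul, ← convInr_mul, toConv_antipode_mul_id, toConv_id_mul_antipode]
    refine WithConv.ext (LinearMap.ext fun x => ?_)
    exact (convInl_mul_convInr_apply _ _ x).trans ((map_sourceMap_targetMap_comul x).trans
      (convInr_mul_convInl_apply _ _ x).symm)
  · rw [hcomul, hy, ← convInl_mul, toConv_antipode_mul_id]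
    refine WithConv.ext (LinearMap.ext fun x => ?_)
    have r := Coalgebra.Repr.arbitrary k x
    have hsource (y : H) : map (sourceMap k H) LinearMap.id (Δ y) = ((1 : H) ⊗ₜ[k] y) * Δ 1 :=
      rTensor_sourceMap_comul y
    simp only [r.convMul_apply, convInl_mul_convInr_apply, hsource]
    simp [← mul_assoc, ← Finset.sum_mul, ← tmul_sum, sum_antipode_mul r, comul_sourceMap]
  · rw [hcomul, hy', ← convInr_mul, toConv_id_mul_antipode, ← mul_assoc]
    refine WithConv.ext (LinearMap.ext fun x => ?_)
    have r := Coalgebra.Repr.arbitrary k x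
    have htarget (y : H) : map LinearMap.id (targetMap k H) (Δ y) = Δ 1 * (y ⊗ₜ[k] (1 : H)) :=
      lTensor_targetMap_comul y
    simp only [r.convMul_apply, convInl_mul_convInr_apply, htarget]
    simp [mul_assoc, ← Finset.mul_sum, ← sum_tmul, sum_mul_antipode r, comul_targetMap]

theorem comul_antipode (h : H) : Δ (𝒮 h) = TensorProduct.comm k H H (map 𝒮 𝒮 (Δ h)) :=
  (LinearMap.congr_fun (congrArg ofConv toConv_comul_comp_antipode) h).trans
    (convInr_mul_convInl_apply _ _ h)

theorem targetMap_sourceMap (h : H) : targetMap k H (sourceMap k H h) = 𝒮 (sourceMap k H h) := by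
  have r := Coalgebra.Repr.arbitrary k (1 : H)
  have hcomul : Δ (sourceMap k H h) = ∑ i ∈ r.index, r.left i ⊗ₜ (sourceMap k H h * r.right i) := by
    rw [comul_sourceMap, ← r.eq]
    simp [Finset.mul_sum]
  calc targetMap k H (sourceMap k H h)
      = (∑ i ∈ r.index, r.left i * 𝒮 (r.right i)) * 𝒮 (sourceMap k H h) := by
        rw [← id_conv_antipode]
        simp [convolution, hcomul, antipode_mul, mul_assoc, Finset.sum_mul]
    _ = 𝒮 (sourceMap k H h) := by rw [sum_mul_antipode, targetMap_one, one_mul]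

variable (k H) in
theorem antipode_one : 𝒮 (1 : H) = 1 := by
  simpa only [sourceMap_one, targetMap_one, eq_comm] using targetMap_sourceMap (k := k) (1 : H)

variable (k H) in
theorem map_antipode_antipode_comul_one : map 𝒮 𝒮 (Δ 1) = TensorProduct.comm k H H (Δ 1) := by
  rw [← LinearEquiv.symm_apply_eq, comm_symm, ← comul_antipode, antipode_one]

end WeakHopfAlgebra

end WeakHopfAlgebra

section TraceIntegral

open Coalgebra TensorProduct WithConv

variable {k : Type u} {H : Type v} [Field k] [Ring H] [Algebra k H] [Coalgebra k H]

local notation "Δ" => Coalgebra.comul (R := k) (A := H)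
local notation "ε" => Coalgebra.counit (R := k) (A := H)
local notation "𝒮" => WeakHopfAlgebra.antipode (k := k) (H := H)

theorem WeakBialgebra.rightHit_comp_targetMap_mul [WeakBialgebra k H] (θ : H →ₗ[k] k) (x g : H) :
    rightHit (θ ∘ₗ targetMap k H) (x * g) = rightHit (θ ∘ₗ targetMap k H) x * g := by
  rw [rightHit_apply, rightHit_apply, ← contractFst_rTensor, ← contractFst_rTensor,
    rTensor_targetMap_comul, rTensor_targetMap_comul x, contractFst_mul_one_tmul,
    contractFst_mul_one_tmul, mul_assoc]

namespace WeakHopfAlgebra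

open WeakBialgebra

variable [WeakHopfAlgebra k H]

variable (k H) in
theorem rTensor_targetMap_comul_one :
    (targetMap k H).rTensor H (Δ 1) = (𝒮).rTensor H (Δ 1) := by
  have hsource : (sourceMap k H).rTensor H (Δ 1) = Δ 1 :=
    (rTensor_sourceMap_comul 1).trans (one_mul (Δ 1))
  have hcomp : targetMap k H ∘ₗ sourceMap k H = 𝒮 ∘ₗ sourceMap k H :=
    LinearMap.ext fun h => targetMap_sourceMap (k := k) h
  calc (targetMap k H).rTensor H (Δ 1)
      = (targetMap k H ∘ₗ sourceMap k H).rTensor H (Δ 1) := by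
        rw [LinearMap.rTensor_comp_apply, hsource]
    _ = (𝒮).rTensor H (Δ 1) := by rw [hcomp, LinearMap.rTensor_comp_apply, hsource]

theorem map_targetMap_antipode_comul (h : H) :
    map (targetMap k H) 𝒮 (Δ h) = ((1 : H) ⊗ₜ[k] 𝒮 h) * TensorProduct.comm k H H (Δ 1) := by
  have r := Coalgebra.Repr.arbitrary k (1 : H)
  rw [← LinearMap.lTensor_comp_rTensor, LinearMap.comp_apply, rTensor_targetMap_comul,
    rTensor_targetMap_comul_one, ← map_antipode_antipode_comul_one, ← r.eq]
  simp [Finset.sum_mul, Finset.mul_sum, antipode_mul]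

theorem sum_tmul_mul_comul_antipode {h : H} {ι : Type*} (r : Coalgebra.Repr k h ι) :
    ∑ i ∈ r.index, ((1 : H) ⊗ₜ[k] r.left i) * Δ (𝒮 (r.right i)) = (𝒮 h ⊗ₜ[k] (1 : H)) * Δ 1 := by
  have hconv : convInr H (toConv LinearMap.id) * toConv (Δ ∘ₗ 𝒮) =
      convInr H (toConv (targetMap k H)) * convInl H (toConv 𝒮) := by
    rw [toConv_comul_comp_antipode, ← mul_assoc, ← convInr_mul, toConv_id_mul_antipode]
  have hcomm : TensorProduct.comm k H H (((1 : H) ⊗ₜ[k] 𝒮 h) * TensorProduct.comm k H H (Δ 1)) =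
      (𝒮 h ⊗ₜ[k] (1 : H)) * Δ 1 := by
    have s := Coalgebra.Repr.arbitrary k (1 : H)
    simp [← s.eq, Finset.mul_sum]
  rw [← hcomm, ← map_targetMap_antipode_comul]
  have := LinearMap.congr_fun (congrArg ofConv hconv) h
  rw [convInr_mul_convInl_apply] at this
  simpa [r.convMul_apply] using this

theorem comm_map_antipode_mul (y z : H ⊗[k] H) :
    TensorProduct.comm k H H (map 𝒮 𝒮 (y * z)) =
      TensorProduct.comm k H H (map 𝒮 𝒮 z) * TensorProduct.comm k H H (map 𝒮 𝒮 y) := by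
  induction y with
  | zero => simp
  | add y y' hy hy' => simp only [add_mul, map_add, mul_add, hy, hy']
  | tmul a b =>
    induction z with
    | zero => simp
    | add z z' hz hz' => simp only [mul_add, map_add, add_mul, hz, hz']
    | tmul c d => simp [antipode_mul]

theorem sum_comul_antipode_antipode_mul {h : H} {ι : Type*} (r : Coalgebra.Repr k h ι) :
    ∑ i ∈ r.index, Δ (𝒮 (𝒮 (r.right i))) * (𝒮 (r.left i) ⊗ₜ[k] (1 : H)) =
      Δ 1 * ((1 : H) ⊗ₜ[k] 𝒮 (𝒮 h)) := by
  have key := congrArg (fun z => TensorProduct.comm k H H (map 𝒮 𝒮 z))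
    (sum_tmul_mul_comul_antipode r)
  simpa [comm_map_antipode_mul, ← comul_antipode, antipode_one] using key

/-- The functional `x ↦ tr(w ↦ φ ⇀ (xS²(w)))`, for the left action `φ ⇀ h = h₁φ(h₂)`. These
functionals stand in for a normalized integral: `traceIntegral φ ⇀ x` always lies in `H_t`
(`targetMap_leftHit_traceIntegral`), and together they recover the counit
(`sum_traceIntegral_mul_antipode`). -/
def traceIntegral (φ : H →ₗ[k] k) : H →ₗ[k] k :=
  LinearMap.trace k H ∘ₗ LinearMap.llcomp k H H H (leftHit φ) ∘ₗ
    LinearMap.lcomp k H (𝒮 ∘ₗ 𝒮) ∘ₗ LinearMap.mul k H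

theorem traceIntegral_apply (φ : H →ₗ[k] k) (x : H) : traceIntegral φ x =
    LinearMap.trace k H (leftHit φ ∘ₗ LinearMap.mulLeft k x ∘ₗ 𝒮 ∘ₗ 𝒮) := rfl

variable {ι : Type*} [Fintype ι] (b : Module.Basis ι k H)

theorem sum_antipode_leftHit_mul (x : H) :
    ∑ i, 𝒮 (leftHit (b.coord i) x) * b i = sourceMap k H x := by
  have r := Coalgebra.Repr.arbitrary k x
  calc ∑ i, 𝒮 (leftHit (b.coord i) x) * b i
      = ∑ j ∈ r.index, 𝒮 (r.left j) * ∑ i, b.repr (r.right j) i • b i := by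
        simp only [leftHit_apply, ← r.eq, map_sum, contractSnd_tmul, map_smul, Finset.sum_mul,
          Finset.mul_sum, smul_mul_assoc, mul_smul_comm, b.coord_apply,
          Finset.sum_comm (s := r.index)]
    _ = sourceMap k H x := by simp only [b.sum_repr, sum_antipode_mul]

theorem rightHit_comp_targetMap (θ : H →ₗ[k] k) (x : H) :
    rightHit (θ ∘ₗ targetMap k H) x =
      ∑ i, rightHit (b.coord i ∘ₗ 𝒮) (rightHit (θ ∘ₗ LinearMap.mulRight k (b i)) x) := by
  have htarget (y : H) : θ (targetMap k H y) =
      ∑ i, b.coord i (𝒮 (rightHit (θ ∘ₗ LinearMap.mulRight k (b i)) y)) := by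
    have r := Coalgebra.Repr.arbitrary k y
    calc θ (targetMap k H y)
        = ∑ j ∈ r.index, θ (r.left j * ∑ i, b.repr (𝒮 (r.right j)) i • b i) := by
          simp only [b.sum_repr, ← map_sum, sum_mul_antipode]
      _ = _ := by
          simp only [Finset.mul_sum, mul_smul_comm, map_sum, map_smul, smul_eq_mul,
            Finset.sum_comm (s := r.index)]
          simp [rightHit_apply, ← r.eq, mul_comm]
  have r := Coalgebra.Repr.arbitrary k x
  simp only [rightHit_rightHit]
  simp [rightHit_apply _ x, ← r.eq, htarget, Finset.sum_smul, Finset.sum_comm (s := r.index)]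

theorem rightHit_mul_antipode_antipode (θ : H →ₗ[k] k) (x w : H) :
    rightHit θ x * 𝒮 (𝒮 w) = ∑ i, rightHit (θ ∘ₗ LinearMap.mulRight k (b i))
      (x * 𝒮 (𝒮 (rightHit (b.coord i ∘ₗ 𝒮) w))) := by
  have r := Coalgebra.Repr.arbitrary k w
  have hcomul : Δ x * ((1 : H) ⊗ₜ[k] 𝒮 (𝒮 w)) = ∑ j ∈ r.index,
      Δ (x * 𝒮 (𝒮 (r.right j))) * (𝒮 (r.left j) ⊗ₜ[k] (1 : H)) := by
    simp only [comul_mul x, mul_assoc, ← Finset.mul_sum, sum_comul_antipode_antipode_mul]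
    rw [← mul_assoc, comul_mul_comul_one]
  calc rightHit θ x * 𝒮 (𝒮 w)
      = ∑ j ∈ r.index, contractFst H θ
          (Δ (x * 𝒮 (𝒮 (r.right j))) * ((∑ i, b.repr (𝒮 (r.left j)) i • b i) ⊗ₜ[k] (1 : H))) := by
        simp only [b.sum_repr, rightHit_apply, ← contractFst_mul_one_tmul, hcomul, map_sum]
    _ = ∑ i, ∑ j ∈ r.index, b.repr (𝒮 (r.left j)) i •
          rightHit (θ ∘ₗ LinearMap.mulRight k (b i)) (x * 𝒮 (𝒮 (r.right j))) := by
        simp only [sum_tmul, ← smul_tmul', Finset.mul_sum, map_sum, mul_smul_comm, map_smul,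
          contractFst_mul_tmul_one, ← rightHit_apply, Finset.sum_comm (s := r.index)]
    _ = _ := by
        simp [rightHit_apply (b.coord _ ∘ₗ 𝒮), ← r.eq, Finset.mul_sum]

variable [FiniteDimensional k H]

theorem sum_traceIntegral_mul_antipode (x : H) :
    ∑ i, traceIntegral (b.coord i) (x * 𝒮 (b i)) = ε x := by
  have r := Coalgebra.Repr.arbitrary k (1 : H)
  have hcyclic (i : ι) : traceIntegral (b.coord i) (x * 𝒮 (b i)) =
      LinearMap.trace k H ((LinearMap.mulRight k (b i) ∘ₗ 𝒮) ∘ₗ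
        leftHit (b.coord i) ∘ₗ LinearMap.mulLeft k x ∘ₗ 𝒮) := by
    rw [LinearMap.trace_comp_comm', traceIntegral_apply]
    congr 1
    ext h
    simp [antipode_mul]
  have hsource : ∑ i, (LinearMap.mulRight k (b i) ∘ₗ 𝒮) ∘ₗ
        leftHit (b.coord i) ∘ₗ LinearMap.mulLeft k x ∘ₗ 𝒮 =
      ∑ j ∈ r.index, (ε ∘ₗ LinearMap.mulRight k (r.right j) ∘ₗ LinearMap.mulLeft k x ∘ₗ
        𝒮).smulRight (r.left j) := by
    ext h
    simpa [LinearMap.sum_apply] using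
      (sum_antipode_leftHit_mul b (x * 𝒮 h)).trans (sourceMap_eq_sum r _)
  calc ∑ i, traceIntegral (b.coord i) (x * 𝒮 (b i))
      = ε (x * ∑ j ∈ r.index, 𝒮 (r.left j) * r.right j) := by
        simp only [hcyclic, ← map_sum (LinearMap.trace k H), hsource]
        simp [Finset.mul_sum, mul_assoc, LinearMap.trace_smulRight]
    _ = ε x := by rw [sum_antipode_mul, sourceMap_one, mul_one]

theorem traceIntegral_rightHit_comp_targetMap (φ θ : H →ₗ[k] k) (x : H) :
    traceIntegral φ (rightHit (θ ∘ₗ targetMap k H) x) = traceIntegral φ (rightHit θ x) := by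
  have b := Module.finBasis k H
  let K (i) : H →ₗ[k] H :=
    leftHit φ ∘ₗ rightHit (θ ∘ₗ LinearMap.mulRight k (b i)) ∘ₗ LinearMap.mulLeft k x ∘ₗ 𝒮 ∘ₗ 𝒮
  have htarget : leftHit φ ∘ₗ LinearMap.mulLeft k (rightHit (θ ∘ₗ targetMap k H) x) ∘ₗ 𝒮 ∘ₗ 𝒮 =
      ∑ i, rightHit (b.coord i ∘ₗ 𝒮) ∘ₗ K i := by
    ext w
    simp only [LinearMap.comp_apply, LinearMap.mulLeft_apply, ← rightHit_comp_targetMap_mul]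
    simp [K, LinearMap.sum_apply, rightHit_leftHit, rightHit_comp_targetMap b]
  have hid : leftHit φ ∘ₗ LinearMap.mulLeft k (rightHit θ x) ∘ₗ 𝒮 ∘ₗ 𝒮 =
      ∑ i, K i ∘ₗ rightHit (b.coord i ∘ₗ 𝒮) := by
    ext w
    simp [K, LinearMap.sum_apply, rightHit_mul_antipode_antipode b]
  simp only [traceIntegral_apply, htarget, hid, map_sum,
    LinearMap.trace_comp_comm' (rightHit (b.coord _ ∘ₗ 𝒮))]

theorem targetMap_leftHit_traceIntegral (φ : H →ₗ[k] k) (x : H) :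
    targetMap k H (leftHit (traceIntegral φ) x) = leftHit (traceIntegral φ) x := by
  rw [← sub_eq_zero, ← Module.forall_dual_apply_eq_zero_iff k]
  intro θ
  rw [map_sub, sub_eq_zero, ← LinearMap.comp_apply, apply_leftHit, apply_leftHit,
    traceIntegral_rightHit_comp_targetMap]

end WeakHopfAlgebra

end TraceIntegral

section DualBasis

variable {R M ι : Type*} [Semiring R] [AddCommMonoid M] [Module R M] [Fintype ι]

theorem projective_and_finite_of_sum_smul_eq_self (φ : ι → M →ₗ[R] R) (y : ι → M)
    (h : ∀ m, ∑ i, φ i m • y i = m) : Module.Projective R M ∧ Module.Finite R M := by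
  classical
  have hcomp : Fintype.linearCombination R y ∘ₗ LinearMap.pi φ = LinearMap.id :=
    LinearMap.ext fun m => by simpa [Fintype.linearCombination_apply] using h m
  exact ⟨.of_split _ _ hcomp,
    .of_surjective (Fintype.linearCombination R y) (LinearMap.surjective_of_comp_eq_id _ _ hcomp)⟩

end DualBasis

section WeakComoduleAlgebra

open TensorProduct WeakBialgebra WeakHopfAlgebra

variable {k : Type u} {H : Type v} {A : Type w} [Field k] [Ring H] [Algebra k H] [Coalgebra k H]
  [Ring A] [Algebra k A]

local notation "Δ" => Coalgebra.comul (R := k) (A := H)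
local notation "𝒮" => WeakHopfAlgebra.antipode (k := k) (H := H)

namespace WeakComoduleAlgebra

variable (ρ : WeakComoduleAlgebra k H A)

theorem coact_one_mul_coact (a : A) : ρ.coact 1 * ρ.coact a = ρ.coact a := by
  rw [← ρ.coact_mul, one_mul]

theorem coact_mul_coact_one (a : A) : ρ.coact a * ρ.coact 1 = ρ.coact a := by
  rw [← ρ.coact_mul, mul_one]

theorem rTensor_coact_coact_one [WeakBialgebra k H] : ρ.coact.rTensor H (ρ.coact 1) =
    (TensorProduct.assoc k A H H).symm ((1 : A) ⊗ₜ[k] Δ 1) * (ρ.coact 1 ⊗ₜ[k] (1 : H)) := by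
  obtain ⟨t, ht⟩ := ρ.coact_one_mem
  rw [← (TensorProduct.assoc k A H H).symm_apply_apply (ρ.coact.rTensor H (ρ.coact 1)), ρ.coassoc,
    ← ht]
  clear ht
  induction t with
  | zero => simp
  | tmul a x =>
    obtain ⟨h, hx⟩ := x.2
    have r := Coalgebra.Repr.arbitrary k (1 : H)
    simp only [LinearMap.lTensor_tmul, Submodule.subtype_apply, ← hx, comul_targetMap, ← r.eq]
    simp [Finset.sum_mul, tmul_sum]
  | add p q hp hq => simp only [map_add, add_tmul, mul_add, hp, hq]

theorem lTensor_targetMap_coact [WeakBialgebra k H] (a : A) :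
    (targetMap k H).lTensor A (ρ.coact a) = ρ.coact 1 * (a ⊗ₜ[k] (1 : H)) :=
  lTensor_targetMap_of_multiplicative ρ.coact ρ.coact_mul ρ.counit_coact
    ρ.rTensor_coact_coact_one a

/-- The left action `T ⇀ a = a₀T(a₁)` of the dual of `H` on a right `H`-comodule algebra. -/
def dualAction (T : H →ₗ[k] k) : A →ₗ[k] A := contractSnd A T ∘ₗ ρ.coact

theorem dualAction_apply (T : H →ₗ[k] k) (a : A) :
    ρ.dualAction T a = contractSnd A T (ρ.coact a) := rfl

theorem coact_dualAction (T : H →ₗ[k] k) (a : A) :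
    ρ.coact (ρ.dualAction T a) = (leftHit T).lTensor A (ρ.coact a) := by
  rw [dualAction_apply, ← contractSnd_rTensor, ← contractSnd_assoc, ρ.coassoc,
    ← LinearMap.lTensor_comp_apply, leftHit]

theorem dualAction_mem_coinvariants [WeakBialgebra k H] {T : H →ₗ[k] k}
    (hT : ∀ x, targetMap k H (leftHit T x) = leftHit T x) (a : A) :
    ρ.dualAction T a ∈ ρ.coinvariants := by
  have hcomp : targetMap k H ∘ₗ leftHit T = leftHit T := LinearMap.ext hT
  change ρ.coact _ = ρ.coact 1 * _
  rw [← lTensor_targetMap_coact, coact_dualAction, ← LinearMap.lTensor_comp_apply, hcomp]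

theorem dualAction_coinvariants_mul [WeakBialgebra k H] (T : H →ₗ[k] k) (b : ρ.coinvariants)
    (a : A) : ρ.dualAction T (b * a) = b * ρ.dualAction T a := by
  have hcoact : ρ.coact (b * a) = (b : A) • ρ.coact a := by
    rw [ρ.coact_mul, ρ.coact_of_mem_coinvariants b.2, smul_mul_assoc, coact_one_mul_coact]
  rw [dualAction_apply, dualAction_apply, hcoact]
  induction ρ.coact a with
  | zero => simp
  | tmul p q => simp [smul_tmul']
  | add p q hp hq => simp only [map_add, smul_add, mul_add, hp, hq]

variable [WeakHopfAlgebra k H]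

/-- The map `a ⊗ h ↦ a₀ ⊗ a₁S(h)`, written through the coaction on the first factor so that
coassociativity applies to it. -/
def coactAntipode : A ⊗[k] H →ₗ[k] A ⊗[k] H :=
  (LinearMap.mul' k H ∘ₗ map LinearMap.id 𝒮).lTensor A ∘ₗ
    (TensorProduct.assoc k A H H).toLinearMap ∘ₗ ρ.coact.rTensor H

theorem coactAntipode_tmul (a : A) (h : H) :
    ρ.coactAntipode (a ⊗ₜ[k] h) = ρ.coact a * (1 ⊗ₜ[k] 𝒮 h) := by
  simp only [coactAntipode, LinearMap.comp_apply, LinearMap.rTensor_tmul]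
  induction ρ.coact a with
  | zero => simp
  | tmul p q => simp
  | add p q hp hq => simp only [map_add, add_tmul, add_mul, hp, hq]

theorem coactAntipode_coact (a : A) :
    ρ.coactAntipode (ρ.coact a) = ρ.coact 1 * (a ⊗ₜ[k] 1) := by
  rw [← lTensor_targetMap_coact, ← id_conv_antipode, convolution, ← LinearMap.comp_assoc,
    LinearMap.lTensor_comp_apply, ← ρ.coassoc]
  rfl

theorem coactAntipode_smul (a : A) (z : A ⊗[k] H) :
    ρ.coactAntipode (a • z) = ρ.coact a * ρ.coactAntipode z := by
  induction z with
  | zero => simp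
  | tmul p q => simp only [smul_tmul', coactAntipode_tmul, smul_eq_mul, ρ.coact_mul, mul_assoc]
  | add p q hp hq => simp only [map_add, smul_add, mul_add, hp, hq]

theorem coactAntipode_one_tmul_mul (g : H) (z : A ⊗[k] H) :
    ρ.coactAntipode ((1 ⊗ₜ[k] g) * z) = ρ.coactAntipode z * (1 ⊗ₜ[k] 𝒮 g) := by
  induction z with
  | zero => simp
  | tmul p q => simp [coactAntipode_tmul, antipode_mul, mul_assoc]
  | add p q hp hq => simp only [map_add, add_mul, mul_add, hp, hq]

variable {ρ}

theorem exists_sum_smul_coact_eq (hβ : Function.Surjective ρ.galoisMap) (g : H) :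
    ∃ s : Finset (A × A), ∑ p ∈ s, p.1 • ρ.coact p.2 = (1 ⊗ₜ[k] g) * ρ.coact 1 := by
  obtain ⟨q, hq⟩ := hβ ⟨(1 ⊗ₜ[k] g) * ρ.coact 1, _, rfl⟩
  obtain ⟨t, rfl⟩ := Submodule.Quotient.mk_surjective _ q
  obtain ⟨s, rfl⟩ := TensorProduct.exists_finset t
  have hpre : ρ.preGalois (∑ p ∈ s, p.1 ⊗ₜ[ℤ] p.2) = (1 ⊗ₜ[k] g) * ρ.coact 1 :=
    congrArg Subtype.val hq
  exact ⟨s, by simpa only [map_sum, preGalois_tmul] using hpre⟩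

theorem sum_dualAction_mul {g : H} {s : Finset (A × A)}
    (hs : ∑ p ∈ s, p.1 • ρ.coact p.2 = (1 ⊗ₜ[k] g) * ρ.coact 1) (T : H →ₗ[k] k) (a : A) :
    ∑ p ∈ s, ρ.dualAction T (a * p.1) * p.2 =
      ρ.dualAction (T ∘ₗ LinearMap.mulRight k (𝒮 g)) a := by
  have hcoact : ∑ p ∈ s, ρ.coact p.1 * (p.2 ⊗ₜ[k] (1 : H)) = ρ.coact 1 * ((1 : A) ⊗ₜ[k] 𝒮 g) := by
    have h := congrArg ρ.coactAntipode hs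
    simpa only [map_sum, coactAntipode_smul, coactAntipode_coact, coactAntipode_one_tmul_mul,
      ← mul_assoc, coact_mul_coact_one, ← Algebra.TensorProduct.one_def, mul_one] using h
  calc ∑ p ∈ s, ρ.dualAction T (a * p.1) * p.2
      = contractSnd A T (ρ.coact a * ∑ p ∈ s, ρ.coact p.1 * (p.2 ⊗ₜ[k] (1 : H))) := by
        simp only [dualAction_apply, ← contractSnd_mul_tmul_one, ρ.coact_mul, Finset.mul_sum,
          map_sum, mul_assoc]
    _ = ρ.dualAction (T ∘ₗ LinearMap.mulRight k (𝒮 g)) a := by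
        rw [hcoact, ← mul_assoc, coact_mul_coact_one, contractSnd_mul_one_tmul, dualAction_apply]

variable [FiniteDimensional k H]

variable (ρ) in
theorem sum_dualAction_traceIntegral {ι : Type*} [Fintype ι] (b : Module.Basis ι k H) (a : A) :
    ∑ i, ρ.dualAction (traceIntegral (b.coord i) ∘ₗ LinearMap.mulRight k (𝒮 (b i))) a = a := by
  have hcounit (z : A ⊗[k] H) :
      ∑ i, contractSnd A (traceIntegral (b.coord i) ∘ₗ LinearMap.mulRight k (𝒮 (b i))) z =
        contractSnd A Coalgebra.counit z := by
    induction z with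
    | zero => simp
    | tmul p q => simp [← Finset.sum_smul, sum_traceIntegral_mul_antipode b q]
    | add p q hp hq => simp only [map_add, Finset.sum_add_distrib, hp, hq]
  exact (hcounit (ρ.coact a)).trans (ρ.counit_coact a)

variable (ρ) in
/-- The map `a ↦ a₀T(a₁)` for `T = traceIntegral φ`, as a left linear map to the coinvariants. -/
def coinvariantTrace (φ : H →ₗ[k] k) : A →ₗ[ρ.coinvariants] ρ.coinvariants where
  toFun a := ⟨ρ.dualAction (traceIntegral φ) a,
    ρ.dualAction_mem_coinvariants (targetMap_leftHit_traceIntegral φ) a⟩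
  map_add' x y := Subtype.ext (map_add _ x y)
  map_smul' c x := Subtype.ext (ρ.dualAction_coinvariants_mul _ c x)

theorem projective_and_finite_of_surjective_galoisMap (hβ : Function.Surjective ρ.galoisMap) :
    Module.Projective ρ.coinvariants A ∧ Module.Finite ρ.coinvariants A := by
  have b := Module.finBasis k H
  choose s hs using exists_sum_smul_coact_eq hβ
  refine projective_and_finite_of_sum_smul_eq_self
    (ι := Σ i : Fin (Module.finrank k H), s (b i))
    (fun j => ρ.coinvariantTrace (b.coord j.1) ∘ₗ LinearMap.mulRight ρ.coinvariants j.2.1.1)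
    (fun j => j.2.1.2) fun a => ?_
  calc ∑ j : Σ i : Fin (Module.finrank k H), s (b i),
        (ρ.coinvariantTrace (b.coord j.1) (a * j.2.1.1)) • j.2.1.2
      = ∑ i, ∑ p ∈ s (b i), ρ.dualAction (traceIntegral (b.coord i)) (a * p.1) * p.2 := by
        simp only [Fintype.sum_sigma, ← Finset.sum_coe_sort (s (b _))]
        rfl
    _ = a := by simp only [sum_dualAction_mul (hs _), sum_dualAction_traceIntegral]

end WeakComoduleAlgebra

end WeakComoduleAlgebra

end

theorem theorem2p3_general {k : Type u} {H : Type v} {A : Type w} [Field k]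
    [Ring H] [Algebra k H] [Coalgebra k H] [WeakHopfAlgebra k H] [FiniteDimensional k H]
    [Ring A] [Algebra k A] (ρ : WeakComoduleAlgebra k H A)
    (hβ : Function.Surjective ρ.galoisMap)
    (hflat : IsRightFaithfullyFlat ρ.coinvariants)
    (hfin : finitisticDimension ρ.coinvariants < ⊤) :
    finitisticDimension ρ.coinvariants ≤ finitisticDimension A := by
  obtain ⟨_, _⟩ := WeakComoduleAlgebra.projective_and_finite_of_surjective_galoisMap hβ
  exact hflat.finitisticDimension_le hfin

theorem theorem2p3 {k : Type u} {H : Type v} {A : Type w} [Field k]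
    [Ring H] [Algebra k H] [Coalgebra k H] [WeakHopfAlgebra k H] [FiniteDimensional k H]
    [Ring A] [Algebra k A] (ρ : WeakComoduleAlgebra k H A)
    (hGalois : ρ.IsWeakGalois)
    (hflat : IsRightFaithfullyFlat ρ.coinvariants)
    (hfin : finitisticDimension ρ.coinvariants < ⊤) :
    finitisticDimension ρ.coinvariants ≤ finitisticDimension A := by
  exact theorem2p3_general ρ hGalois.2 hflat hfin
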